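/- **On the structure of $K(Y,\partial Y)$.** Let $n\ge 1$, $m\ge 0$. Work in a local chart: $Y=\{x\in\mathbb R^n : x_n\ge 0\}\times\mathbb R^m$ with $\partial Y=\{x_n=0\}$. Let $G=G_n^\infty Y$ be the space of infinite jets, with coordinates $(x,u^j_I)$, $1\le j\le m$, $I\in\mathbb N_0^n$, and let $\partial G$ be the part of $G$ over $\partial Y$. Let $C^\infty(G)$ and $C^\infty(\partial G)$ be the algebras of smooth functions of finite order, let $D_{x_i}=\partial_{x_i}+\sum_{j,I}u^j_{I+1_i}\,\partial_{u^j_I}$ be the total derivatives, and put $D_I=D_{x_1}^{i_1}\cdots D_{x_n}^{i_n}$ for $I=(i_1,\dots,i_n)$. For $i<n$, $D_{x_i}$ also acts on $C^\infty(\partial G)$. Write $I-i_n:=(i_1,\dots,i_{n-1},0)$ and $|I|=i_1+\dots+i_n$. Let $\Omega_h^k(G)$ be the horizontal $k$-forms, i.e. the free $C^\infty(G)$-module on the forms $dx_{s_1}\wedge\dots\wedge dx_{s_k}$, $s_1<\dots<s_k$, with horizontal differential $d_h$ given by $d_h(f\,dx_S)=\sum_i D_{x_i}(f)\,dx_i\wedge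 dx_S$. Let $\Omega_h^k(G,\partial G)$ be the kernel of the pull-back to the horizontal $k$-forms on $\partial G$ (whose independent variables are $x_1,\dots,x_{n-1}$). Let $\kappa(Y)=C^\infty(G)^m$, and let $\mathcal D(P,Q)$ denote the $\mathcal C$-differential operators, i.e. those generated by module maps and total derivatives. The Spencer differential on $\mathcal D(\kappa(Y),\Omega_h^k(G))$ is $\delta(\square)=d_h\circ\square$. The subspaces $\mathcal D(\kappa(Y),C^\infty(G))\otimes\Omega^k_h(G,\partial G)$, spanned by the operators $f\mapsto\square(f)\,\omega$, form a subcomplex of the Spencer complex, and $K(Y,\partial Y)$ is by definition its cohomology of degree $n$. Let $\kappa^\dagger(Y)$ be the dual of $\kappa(Y)$, which is free over $C^\infty(G)$ on the coordinate projections $D_0^{(j)}$, and let $\kappa^\dagger(\partial G)$ be the free $C^\infty(\partial G)$-module on the coordinate projections $D_0^{(j,\alpha)}$, $1\le j\le m$, $\alpha\in\mathbb N_0$, of $\kappa(\partial G)=\prod_{j,\alpha}C^\infty(\partial G)$. Put $D_I^{(j)}=D_I\circ D_0^{(j)}$. Then: 1. the cocycles of degree $n$ are all of $\mathcal D(\kappa(Y),\Omega_h^n(G))$,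 so that $$K(Y,\partial Y)=\frac{\mathcal D(\kappa(Y),\Omega_h^n(G))}{\delta\bigl(\mathcal D(\kappa(Y),C^\infty(G))\otimes\Omega_h^{n-1}(G,\partial G)\bigr)};$$ 2. every such cocycle is $\square=\sum_{j,I}a_j^I D_I^{(j)}\,dx_1\wedge\dots\wedge dx_n$ for exactly one finite family of functions $a_j^I\in C^\infty(G)$, and there is an $\mathbb R$-linear isomorphism $$K(Y,\partial Y)\;\cong\;\kappa^\dagger(Y)\oplus\kappa^\dagger(\partial G),\qquad [\square]\longmapsto(\boldsymbol E(\square),\boldsymbol E^\partial(\square)),$$ where $$\boldsymbol E(\square)=\sum_{j,I}(-1)^{|I|}D_I(a_j^I)\,D_0^{(j)},$$ $$\boldsymbol E^\partial(\square)=\sum_{I}(-1)^{|I|-i_n}\sum_{j=1}^m\sum_{0\le\alpha<i_n}(-1)^\alpha\, D_{I-i_n}\bigl(D_{x_n}^\alpha(a_j^I)|_{\partial G}\bigr)\,D_0^{(j,\,i_n-\alpha-1)}.$$ -/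

import Mathlib

open scoped ContDiff

set_option maxSynthPendingDepth 3

noncomputable section

namespace RelEuler

/-- Multi-indices `I ∈ ℕ₀ⁿ`. -/
abbrev MIdx (n : ℕ) : Type := Fin n → ℕ

/-- The multi-index `1_i`. -/
def unitIdx {n : ℕ} (i : Fin n) : MIdx n := Pi.single i 1

/-- Infinite jets of `m` functions of `n` independent variables at the points of `X ⊆ ℝⁿ`:
a point is `(x, (u^j_I))` with `x ∈ X`. -/
abbrev Jet {n : ℕ} (X : Set (Fin n → ℝ)) (m : ℕ) : Type := X × (Fin m × MIdx n → ℝ)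

/-- `f` is smooth of finite order: it is the restriction of a smooth function, on the
whole of `ℝⁿ × ℝˢ`, of the variables `x` and of finitely many jet coordinates `u^j_I`.
(It is used for a closed half-space and for a hyperplane, where being smooth is the same as being
the restriction of a smooth function.) -/
def IsSmooth {n : ℕ} (X : Set (Fin n → ℝ)) (m : ℕ) (f : Jet X m → ℝ) : Prop :=
  ∃ (s : Finset (Fin m × MIdx n)) (F : (Fin n → ℝ) × (s → ℝ) → ℝ), ContDiff ℝ ∞ F ∧
    ∀ p : Jet X m, f p = F (p.1, fun k => p.2 k)

theorem restrict_smooth {n m : ℕ} {s t : Finset (Fin m × MIdx n)} (h : s ⊆ t)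
    {F : (Fin n → ℝ) × (s → ℝ) → ℝ} (hF : ContDiff ℝ ∞ F) :
    ContDiff ℝ ∞ (fun q : (Fin n → ℝ) × (t → ℝ) =>
      F (q.1, fun k : s => q.2 ⟨k.1, h k.2⟩)) := by
  refine hF.comp (contDiff_fst.prodMk (contDiff_pi.2 fun k => ?_))
  exact (contDiff_apply ℝ ℝ (⟨k.1, h k.2⟩ : t)).comp contDiff_snd

theorem IsSmooth.map₂ {n m : ℕ} {X : Set (Fin n → ℝ)} {f g : Jet X m → ℝ}
    (hf : IsSmooth X m f) (hg : IsSmooth X m g) (op : ℝ → ℝ → ℝ)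
    (hop : ContDiff ℝ ∞ (fun q : ℝ × ℝ => op q.1 q.2)) :
    IsSmooth X m (fun p => op (f p) (g p)) := by
  classical
  obtain ⟨s, F, hF, hf⟩ := hf
  obtain ⟨t, G, hG, hg⟩ := hg
  refine ⟨s ∪ t, _, hop.comp ((restrict_smooth Finset.subset_union_left hF).prodMk
    (restrict_smooth Finset.subset_union_right hG)), fun p => ?_⟩
  simp only [hf p, hg p, Function.comp]

/-- The algebra of smooth functions (of finite order) on the jets over `X`. -/
def smoothFun {n : ℕ} (X : Set (Fin n → ℝ)) (m : ℕ) : Subalgebra ℝ (Jet X m → ℝ) where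
  carrier := {f | IsSmooth X m f}
  mul_mem' hf hg := IsSmooth.map₂ hf hg (fun a b => a * b) (contDiff_fst.mul contDiff_snd)
  add_mem' hf hg := IsSmooth.map₂ hf hg (fun a b => a + b) (contDiff_fst.add contDiff_snd)
  algebraMap_mem' c := ⟨∅, fun _ => c, contDiff_const, fun _ => rfl⟩

open Classical in
/-- The total derivative `D_{x_i} = ∂_{x_i} + ∑ u^j_{I+1_i} ∂_{u^j_I}` of a function on jets, as the
derivative in the direction `(e_i, (u^j_{I+1_i}))`; it is one-sided at a boundary point of `X` if
`e_i` is transversal to the boundary. -/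
def totalDerivFun {n : ℕ} (X : Set (Fin n → ℝ)) (m : ℕ) (i : Fin n) (f : Jet X m → ℝ)
    (p : Jet X m) : ℝ :=
  derivWithin (fun t : ℝ =>
      if h : (p.1 : Fin n → ℝ) + t • Pi.single i 1 ∈ X then
        f (⟨(p.1 : Fin n → ℝ) + t • Pi.single i 1, h⟩,
          p.2 + t • fun k => p.2 (k.1, k.2 + unitIdx i))
      else 0)
    {t : ℝ | (p.1 : Fin n → ℝ) + t • Pi.single i 1 ∈ X} 0

/-- `X` is stable under translation by nonnegative multiples of the `i`-th basis vector. -/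
def Stable {n : ℕ} (X : Set (Fin n → ℝ)) (i : Fin n) : Prop :=
  ∀ x ∈ X, ∀ t : ℝ, 0 ≤ t → x + t • Pi.single i 1 ∈ X

theorem totalDerivFun_eq {n m : ℕ} {X : Set (Fin n → ℝ)} {i : Fin n} (hX : Stable X i)
    {f : Jet X m → ℝ} {s : Finset (Fin m × MIdx n)} {F : (Fin n → ℝ) × (s → ℝ) → ℝ}
    (hF : ContDiff ℝ ∞ F) (hf : ∀ p : Jet X m, f p = F (p.1, fun k => p.2 k)) (p : Jet X m) :
    totalDerivFun X m i f p = fderiv ℝ F (p.1, fun k => p.2 k)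
      (Pi.single i 1, fun k => p.2 (k.1.1, k.1.2 + unitIdx i)) := by
  classical
  set q : (Fin n → ℝ) × (s → ℝ) := (p.1, fun k => p.2 k) with hq
  set v : (Fin n → ℝ) × (s → ℝ) := (Pi.single i 1, fun k => p.2 (k.1.1, k.1.2 + unitIdx i)) with hv
  have hline : HasDerivAt (fun t : ℝ => q + t • v) v 0 := by
    simpa using ((hasDerivAt_id (0 : ℝ)).smul_const v).const_add q
  have hd : HasDerivAt (fun t : ℝ => F (q + t • v)) (fderiv ℝ F q v) 0 := by
    have h1 : HasFDerivAt F (fderiv ℝ F q) (q + (0 : ℝ) • v) := by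
      simpa using (hF.differentiable (by simp) q).hasFDerivAt
    exact h1.comp_hasDerivAt (0 : ℝ) hline
  have hu : UniqueDiffWithinAt ℝ {t : ℝ | (p.1 : Fin n → ℝ) + t • Pi.single i 1 ∈ X} 0 :=
    (uniqueDiffWithinAt_Ici (0 : ℝ)).mono fun t ht => hX _ p.1.2 t ht
  refine HasDerivWithinAt.derivWithin (hd.hasDerivWithinAt.congr ?_ ?_) hu
  · intro t ht
    have ht' : (p.1 : Fin n → ℝ) + t • Pi.single i 1 ∈ X := ht
    simp only [dif_pos ht', hf]
    rfl
  · have h0 : (p.1 : Fin n → ℝ) + (0 : ℝ) • Pi.single i 1 ∈ X := by simp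
    simp only [dif_pos h0, hf]
    rfl

theorem totalDerivFun_smooth {n m : ℕ} {X : Set (Fin n → ℝ)} {i : Fin n} (hX : Stable X i)
    {f : Jet X m → ℝ} (hf : IsSmooth X m f) : IsSmooth X m (totalDerivFun X m i f) := by
  classical
  obtain ⟨s, F, hF, hf⟩ := hf
  let sh : Fin m × MIdx n → Fin m × MIdx n := fun k => (k.1, k.2 + unitIdx i)
  have hs : s ⊆ s ∪ s.image sh := Finset.subset_union_left
  have hs' : ∀ k : s, sh k.1 ∈ s ∪ s.image sh := fun k =>
    Finset.mem_union_right _ (Finset.mem_image_of_mem _ k.2)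
  refine ⟨s ∪ s.image sh, fun q => fderiv ℝ F (q.1, fun k : s => q.2 ⟨k.1, hs k.2⟩)
    (Pi.single i 1, fun k : s => q.2 ⟨sh k.1, hs' k⟩), ?_, fun p => ?_⟩
  · have h1 : ContDiff ℝ ∞ (fderiv ℝ F) := hF.fderiv_right (by simp)
    refine (h1.comp (contDiff_fst.prodMk (contDiff_pi.2 fun k => ?_))).clm_apply
      (contDiff_const.prodMk (contDiff_pi.2 fun k => ?_))
    · exact (contDiff_apply ℝ ℝ (⟨k.1, hs k.2⟩ : (s ∪ s.image sh : Finset _))).comp contDiff_snd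
    · exact (contDiff_apply ℝ ℝ (⟨sh k.1, hs' k⟩ : (s ∪ s.image sh : Finset _))).comp contDiff_snd
  · exact totalDerivFun_eq hX hF hf p

/-- The total derivative `D_{x_i}` as an operator on smooth functions. -/
def totalDeriv {n : ℕ} (X : Set (Fin n → ℝ)) (m : ℕ) (i : Fin n) (hX : Stable X i) :
    smoothFun X m →ₗ[ℝ] smoothFun X m where
  toFun f := ⟨totalDerivFun X m i f.1, totalDerivFun_smooth hX f.2⟩
  map_add' f g := by
    classical
    apply Subtype.ext
    funext p
    obtain ⟨s, F, hF, hf⟩ := f.2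
    obtain ⟨t, G, hG, hg⟩ := g.2
    have hs : s ⊆ s ∪ t := Finset.subset_union_left
    have ht : t ⊆ s ∪ t := Finset.subset_union_right
    have hF' := restrict_smooth hs hF
    have hG' := restrict_smooth ht hG
    have e1 := totalDerivFun_eq hX hF' (f := f.1) (fun p => hf p) p
    have e2 := totalDerivFun_eq hX hG' (f := g.1) (fun p => hg p) p
    have e3 := totalDerivFun_eq hX (hF'.add hG') (f := f.1 + g.1)
      (fun p => by simp only [Pi.add_apply]; rw [hf p, hg p]) p
    change totalDerivFun X m i (f.1 + g.1) p =
      totalDerivFun X m i f.1 p + totalDerivFun X m i g.1 p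
    rw [e1, e2, e3, fderiv_fun_add (hF'.differentiable (by simp) _)
      (hG'.differentiable (by simp) _)]
    rfl
  map_smul' c f := by
    apply Subtype.ext
    funext p
    obtain ⟨s, F, hF, hf⟩ := f.2
    have e1 := totalDerivFun_eq hX hF hf p
    have e2 := totalDerivFun_eq hX (hF.const_smul c) (f := c • f.1)
      (fun p => by simp only [Pi.smul_apply]; rw [hf p]) p
    change totalDerivFun X m i (c • f.1) p = c • totalDerivFun X m i f.1 p
    rw [e1, e2, fderiv_fun_const_smul (hF.differentiable (by simp) _)]
    rfl

/-! ### The chart `Y = {x_n ≥ 0} × ℝᵐ`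

There are `n = d + 1` independent variables; the last one is `x_n`. -/

/-- `{x_n ≥ 0}`. -/
def halfSpace (d : ℕ) : Set (Fin (d + 1) → ℝ) := {x | 0 ≤ x (Fin.last d)}

/-- `{x_n = 0}`. -/
def hyperplane (d : ℕ) : Set (Fin (d + 1) → ℝ) := {x | x (Fin.last d) = 0}

theorem halfSpace_stable (d : ℕ) (i : Fin (d + 1)) : Stable (halfSpace d) i := by
  intro x hx t ht
  have hx' : 0 ≤ x (Fin.last d) := hx
  have h : (0 : ℝ) ≤ (Pi.single i 1 : Fin (d + 1) → ℝ) (Fin.last d) := by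
    rw [Pi.single_apply]
    split_ifs <;> simp
  change 0 ≤ x (Fin.last d) + t * (Pi.single i 1 : Fin (d + 1) → ℝ) (Fin.last d)
  positivity

theorem hyperplane_stable (d : ℕ) (i : Fin d) : Stable (hyperplane d) i.castSucc := by
  intro x hx t _
  have hx' : x (Fin.last d) = 0 := hx
  change x (Fin.last d) + t * (Pi.single i.castSucc 1 : Fin (d + 1) → ℝ) (Fin.last d) = 0
  rw [Pi.single_eq_of_ne (Fin.castSucc_lt_last i).ne', hx']
  simp

/-- `C^∞(G_n^∞ Y)`. -/
def FunG (d m : ℕ) : Type := smoothFun (halfSpace d) m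

instance (d m : ℕ) : CommRing (FunG d m) := inferInstanceAs (CommRing (smoothFun (halfSpace d) m))

instance (d m : ℕ) : Algebra ℝ (FunG d m) :=
  inferInstanceAs (Algebra ℝ (smoothFun (halfSpace d) m))

/-- `C^∞(∂G_n^∞ Y)`, where `∂G_n^∞ Y` consists of the jets over `∂Y = {x_n = 0}`. -/
def FunBd (d m : ℕ) : Type := smoothFun (hyperplane d) m

instance (d m : ℕ) : CommRing (FunBd d m) :=
  inferInstanceAs (CommRing (smoothFun (hyperplane d) m))

instance (d m : ℕ) : Algebra ℝ (FunBd d m) :=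
  inferInstanceAs (Algebra ℝ (smoothFun (hyperplane d) m))

/-- The total derivatives `D_{x_1}, …, D_{x_n}` on `C^∞(G_n^∞ Y)`. -/
def D (d m : ℕ) (i : Fin (d + 1)) : FunG d m →ₗ[ℝ] FunG d m :=
  totalDeriv (halfSpace d) m i (halfSpace_stable d i)

/-- The total derivatives `D_{x_1}, …, D_{x_{n-1}}` on `C^∞(∂G_n^∞ Y)`. -/
def DBd (d m : ℕ) (i : Fin d) : FunBd d m →ₗ[ℝ] FunBd d m :=
  totalDeriv (hyperplane d) m i.castSucc (hyperplane_stable d i)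

/-- `D_I = D_{x_1}^{i_1} ∘ ⋯ ∘ D_{x_n}^{i_n}`. -/
def DI (d m : ℕ) (I : MIdx (d + 1)) : FunG d m →ₗ[ℝ] FunG d m :=
  (List.ofFn fun i => (D d m i ^ I i : Module.End ℝ (FunG d m))).prod

/-- `D_J` on `C^∞(∂G_n^∞ Y)`, for a multi-index `J` of length `n - 1`. -/
def DIBd (d m : ℕ) (J : MIdx d) : FunBd d m →ₗ[ℝ] FunBd d m :=
  (List.ofFn fun i => (DBd d m i ^ J i : Module.End ℝ (FunBd d m))).prod

/-- The inclusion `∂G_n^∞ Y ⊆ G_n^∞ Y`. -/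
def inclBd (d m : ℕ) (p : Jet (hyperplane d) m) : Jet (halfSpace d) m :=
  (⟨p.1.1, ge_of_eq p.1.2⟩, p.2)

/-- The restriction of functions `f ↦ f|_{∂G_n^∞ Y}`. -/
def res (d m : ℕ) (f : FunG d m) : FunBd d m :=
  ⟨f.1 ∘ inclBd d m, by
    obtain ⟨s, F, hF, hf⟩ := f.2
    exact ⟨s, F, hF, fun p => hf (inclBd d m p)⟩⟩

/-! ### Horizontal forms -/

/-- Horizontal `k`-forms `∑_S θ_S dx_S` on `G_n^∞ Y`, where `S` runs over the `k`-element subsets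
of the set of independent variables and `dx_S` is the wedge product in increasing order. -/
abbrev HForm (d m k : ℕ) : Type := {S : Finset (Fin (d + 1)) // S.card = k} → FunG d m

/-- Horizontal `k`-forms on `∂G_n^∞ Y`, where the independent variables are
`x_1, …, x_{n-1}`. -/
abbrev HFormBd (d m k : ℕ) : Type := {S : Finset (Fin d) // S.card = k} → FunBd d m

/-- The horizontal differential `d_h (f dx_S) = ∑_i D_{x_i}(f) dx_i ∧ dx_S`. -/
def dh (d m k : ℕ) : HForm d m k →ₗ[ℝ] HForm d m (k + 1) :=
  LinearMap.pi fun T => ∑ i : {i // i ∈ T.1},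
    ((-1 : ℝ) ^ (T.1.filter (· < i.1)).card) •
      (D d m i.1 ∘ₗ LinearMap.proj (⟨T.1.erase i.1, by
        rw [Finset.card_erase_of_mem i.2, T.2]; rfl⟩ : {S : Finset (Fin (d + 1)) // S.card = k}))

/-- The pull-back of horizontal forms to `∂G_n^∞ Y`: `dx_n ↦ 0`, and functions are restricted. -/
def pullBd (d m k : ℕ) (θ : HForm d m k) : HFormBd d m k :=
  fun S => res d m (θ ⟨S.1.map Fin.castSuccEmb, by rw [Finset.card_map, S.2]⟩)

/-- The relative horizontal forms `Ω_h^k(G_n^∞ Y, ∂G_n^∞ Y)`: those whose pull-back to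
`∂G_n^∞ Y` is zero. -/
def relForm (d m k : ℕ) : Set (HForm d m k) := {θ | pullBd d m k θ = 0}

/-- The horizontal volume form `dx_1 ∧ ⋯ ∧ dx_n`. -/
def vol (d m : ℕ) : HForm d m (d + 1) := fun _ => 1

/-! ### `𝒞`-differential operators -/

/-- The algebra of scalar `𝒞`-differential operators: the subalgebra of `End_ℝ C^∞(G_n^∞ Y)`
generated by multiplications by functions and total derivatives. -/
def scalarCDiff (d m : ℕ) : Subalgebra ℝ (Module.End ℝ (FunG d m)) :=
  Algebra.adjoin ℝ (Set.range (LinearMap.mulLeft ℝ : FunG d m → Module.End ℝ (FunG d m)) ∪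
    Set.range (fun i => (D d m i : Module.End ℝ (FunG d m))))

/-- The `𝒞`-differential operators `𝒟(P, Q)` between (free) modules over `C^∞(G_n^∞ Y)`: sums of
operators `p ↦ □(φ(p)) q` with a scalar operator `□`, a module map `φ` from `P` to
`C^∞(G_n^∞ Y)`, and `q ∈ Q`. -/
def CDiff (d m : ℕ) (P Q : Type) [AddCommGroup P] [Module (FunG d m) P] [Module ℝ P]
    [AddCommGroup Q] [Module (FunG d m) Q] [Module ℝ Q] : Submodule ℝ (P →ₗ[ℝ] Q) :=
  Submodule.span ℝ {Δ | ∃ B ∈ scalarCDiff d m, ∃ (φ : P →ₗ[FunG d m] FunG d m) (q : Q),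
    ∀ p, Δ p = B (φ p) • q}

/-- `κ(Y)`, in coordinates. -/
abbrev Kappa (d m : ℕ) : Type := Fin m → FunG d m

/-- The Spencer differential `δ(Δ) = d_h ∘ Δ`. -/
def spencer (d m k : ℕ) :
    (Kappa d m →ₗ[ℝ] HForm d m k) →ₗ[ℝ] (Kappa d m →ₗ[ℝ] HForm d m (k + 1)) :=
  LinearMap.compRight ℝ (dh d m k)

/-- `𝒟(κ(Y), C^∞(G_n^∞ Y)) ⊗ Ω_h^k(G_n^∞ Y, ∂G_n^∞ Y)` inside `𝒟(κ(Y), Ω_h^k(G_n^∞ Y))`: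
the sums of the operators `Δ ⊗ θ : f ↦ Δ(f) θ`. -/
def relCochains (d m k : ℕ) : Submodule ℝ (Kappa d m →ₗ[ℝ] HForm d m k) :=
  Submodule.span ℝ {Θ | ∃ Δ ∈ CDiff d m (Kappa d m) (FunG d m), ∃ θ ∈ relForm d m k,
    ∀ f, Θ f = Δ f • θ}

/-- The cocycles of degree `k` of the relative Spencer complex. -/
def relCocycles (d m k : ℕ) : Submodule ℝ (Kappa d m →ₗ[ℝ] HForm d m k) :=
  relCochains d m k ⊓ LinearMap.ker (spencer d m k)

/-- The coboundaries of degree `k + 1` of the relative Spencer complex. -/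
def relCoboundaries (d m k : ℕ) : Submodule ℝ (Kappa d m →ₗ[ℝ] HForm d m (k + 1)) :=
  (relCochains d m k).map (spencer d m k)

/-- `K(Y, ∂Y)`: the cohomology of degree `n = d + 1` of the relative Spencer complex. -/
abbrev K (d m : ℕ) : Type :=
  ↥(relCocycles d m (d + 1)) ⧸
    (relCoboundaries d m d).comap (relCocycles d m (d + 1)).subtype

/-- `𝒟(κ(Y), Ω_h^n)`. -/
abbrev TopOps (d m : ℕ) : Submodule ℝ (Kappa d m →ₗ[ℝ] HForm d m (d + 1)) :=
  CDiff d m (Kappa d m) (HForm d m (d + 1))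

/-- `𝒟(κ(Y), Ω_h^n) / δ(𝒟(κ(Y), C^∞(G_n^∞ Y)) ⊗ Ω_h^{n-1}(G_n^∞ Y, ∂G_n^∞ Y))`. -/
abbrev TopQuot (d m : ℕ) : Type :=
  ↥(TopOps d m) ⧸ (relCoboundaries d m d).comap (TopOps d m).subtype

/-! ### Coordinates of operators and the Euler maps -/

/-- The coefficients `a = (a_j^I)`, finitely many of them being nonzero. -/
abbrev Coeffs (d m : ℕ) : Type := Fin m × MIdx (d + 1) →₀ FunG d m

/-- `D_I^{(j)} = D_I ∘ D_0^{(j)}`, where `D_0^{(j)}` is the projection to the `j`-th component. -/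
def DIj (d m : ℕ) (k : Fin m × MIdx (d + 1)) : Kappa d m →ₗ[ℝ] FunG d m :=
  DI d m k.2 ∘ₗ LinearMap.proj k.1

/-- The operator `f ↦ (∑ a_j^I D_I^{(j)} f) dx_1 ∧ ⋯ ∧ dx_n`. -/
def coordOp (d m : ℕ) (a : Coeffs d m) : Kappa d m →ₗ[ℝ] HForm d m (d + 1) :=
  (LinearMap.toSpanSingleton (FunG d m) (HForm d m (d + 1)) (vol d m)).restrictScalars ℝ ∘ₗ
    a.sum fun k c => LinearMap.mulLeft ℝ c ∘ₗ DIj d m k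

/-- `κ^†(Y)`: the dual of `κ(Y)`, free with basis `(D_0^{(j)})`. -/
abbrev KappaDag (d m : ℕ) : Type := Module.Dual (FunG d m) (Kappa d m)

/-- `κ(∂G_n^∞ Y)`, in coordinates: the components are indexed by `j` and `α ∈ ℕ₀`, the latter
being the order of the derivative with respect to `x_n`. -/
abbrev KappaBd (d m : ℕ) : Type := Fin m × ℕ → FunBd d m

/-- `κ^†(∂G_n^∞ Y)`: the module spanned by the projections `D_0^{(j,α)}` of `κ(∂G_n^∞ Y)`, which
are a basis of it. -/
abbrev KappaDagBd (d m : ℕ) : Submodule (FunBd d m) (Module.Dual (FunBd d m) (KappaBd d m)) :=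
  Submodule.span (FunBd d m)
    (Set.range fun k : Fin m × ℕ => (LinearMap.proj k : Module.Dual (FunBd d m) (KappaBd d m)))

/-- `D_0^{(j)}`. -/
def D0 (d m : ℕ) (j : Fin m) : KappaDag d m := LinearMap.proj j

/-- `D_0^{(j,α)}`. -/
def D0Bd (d m : ℕ) (j : Fin m) (α : ℕ) : KappaDagBd d m :=
  ⟨LinearMap.proj (j, α), Submodule.subset_span ⟨(j, α), rfl⟩⟩

/-- `E(□) = ∑_{I,j} (-1)^{|I|} D_I(a_j^I) D_0^{(j)}`. -/
def euler (d m : ℕ) (a : Coeffs d m) : KappaDag d m :=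
  a.sum fun k c => ((-1 : FunG d m) ^ (∑ i, k.2 i) * DI d m k.2 c) • D0 d m k.1

/-- `E^∂(□) = ∑_I (-1)^{|I|-i_n} ∑_j ∑_{α<i_n} (-1)^α
D_{I-i_n}((D_{x_n}^α a_j^I)|_{∂G_n^∞ Y}) D_0^{(j,i_n-α-1)}`; here `Fin.init I` is `I - i_n`, viewed as
a multi-index of length `n - 1`. -/
def eulerBd (d m : ℕ) (a : Coeffs d m) : KappaDagBd d m :=
  a.sum fun k c => ∑ α ∈ Finset.range (k.2 (Fin.last d)),
    ((-1 : FunBd d m) ^ ((∑ i, k.2 i) - k.2 (Fin.last d)) * (-1 : FunBd d m) ^ α *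
      DIBd d m (Fin.init k.2)
        (res d m ((D d m (Fin.last d) ^ α : Module.End ℝ (FunG d m)) c))) •
      D0Bd d m k.1 (k.2 (Fin.last d) - α - 1)

end RelEuler

end

open RelEuler

/-!
The argument is linear algebra over the commuting derivations `D_{x_i}`, once three analytic facts
are known: the `D_{x_i}` satisfy the Leibniz rule and commute (`totalDeriv_mul`,
`totalDeriv_comm`), those with `i < n` commute with the restriction to `∂G` (`res_D_castSucc`), and
the restriction is surjective (`res_surjective`).

By the Leibniz rule every `𝒞`-differential operator has coordinates `a_j^I`. They are unique
(`opOf_injective`), since at a point of `G` the operator takes the functions `exp (∑ μ_i x_i)`, up to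
a positive factor, to polynomials in `μ` with the coefficients `a_j^I`.

The pull-back of a horizontal `(n-1)`-form to `∂G` only sees its component along
`dx_1 ∧ ⋯ ∧ dx_{n-1}`. Hence the coboundaries of degree `n` are spanned by the compositions
`D_{x_i} ∘ Δ` with `i < n` and arbitrary `Δ`, and `D_{x_n} ∘ Δ` where the coefficients of `Δ`
vanish on `∂G` (`coordOp_mem_relCoboundaries_iff`). It remains to see that `(E, E^∂)` is surjective
and that its kernel consists of these.

* `E` and `E^∂` vanish on coboundaries: the terms cancel in pairs, except that in `E^∂ (D_{x_n} ∘ Δ)`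
  tangential derivatives of the restrictions to `∂G` of the coefficients of `Δ` are left over, and
  these restrictions are zero
  (`eulerBdLin_derivCoeffs_last`).
* Integrating by parts in `x_1, …, x_{n-1}`, every operator becomes, modulo coboundaries, of the form
  `∑ b_j^s D_{x_n}^s ∘ D_0^{(j)}` (`exists_sub_normalCoeffs_mem`). If `E^∂` vanishes on it, then its leading
  coefficients vanish on `∂G`, as they appear as the coefficients of `D_0^{(j,s-1)}` in `E^∂`. So the
  leading part can be integrated by parts in `x_n` as well, and the order drops. An operator of order
  zero is its own Euler expression `E` (`normalCoeffs_mem_of_eulerPair_eq_zero`).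
* The same triangularity of `E^∂` on the operators `c D_{x_n}^{α+1}` gives its surjectivity, and the
  operators of order zero, on which `E^∂` vanishes, adjust `E` (`eulerPair_surjective`).
-/

noncomputable section

namespace RelEuler

/-! ### Total derivatives along lines -/

/-- `φ` extends to all of `ℝ` the restriction of `f` to the line through `p` along which the total
derivative `D_{x_i}` differentiates. -/
def ExtendsAlongLine {n : ℕ} (X : Set (Fin n → ℝ)) (m : ℕ) (i : Fin n) (f : Jet X m → ℝ)
    (p : Jet X m) (φ : ℝ → ℝ) : Prop :=
  ∀ (t : ℝ) (ht : (p.1 : Fin n → ℝ) + t • Pi.single i 1 ∈ X),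
    f (⟨(p.1 : Fin n → ℝ) + t • Pi.single i 1, ht⟩,
      p.2 + t • fun k => p.2 (k.1, k.2 + unitIdx i)) = φ t

theorem ExtendsAlongLine.totalDerivFun_eq {n m : ℕ} {X : Set (Fin n → ℝ)} {i : Fin n}
    (hX : Stable X i) {f : Jet X m → ℝ} {p : Jet X m} {φ : ℝ → ℝ} {φ' : ℝ}
    (h : ExtendsAlongLine X m i f p φ) (hd : HasDerivAt φ φ' 0) :
    totalDerivFun X m i f p = φ' := by
  classical
  have hu : UniqueDiffWithinAt ℝ {t : ℝ | (p.1 : Fin n → ℝ) + t • Pi.single i 1 ∈ X} 0 :=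
    (uniqueDiffWithinAt_Ici (0 : ℝ)).mono fun t ht => hX _ p.1.2 t ht
  refine HasDerivWithinAt.derivWithin (hd.hasDerivWithinAt.congr ?_ ?_) hu
  · intro t ht
    have ht' : (p.1 : Fin n → ℝ) + t • Pi.single i 1 ∈ X := ht
    simp only [dif_pos ht']
    exact h t ht'
  · have h0 : (p.1 : Fin n → ℝ) + (0 : ℝ) • Pi.single i 1 ∈ X := by simp
    simp only [dif_pos h0]
    exact h 0 h0

theorem ExtendsAlongLine.apply_zero {n m : ℕ} {X : Set (Fin n → ℝ)} {i : Fin n}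
    {f : Jet X m → ℝ} {p : Jet X m} {φ : ℝ → ℝ} (h : ExtendsAlongLine X m i f p φ) :
    φ 0 = f p := by
  have h0 : (p.1 : Fin n → ℝ) + (0 : ℝ) • Pi.single i 1 ∈ X := by simp
  rw [← h 0 h0]
  congr 1
  ext <;> simp

theorem IsSmooth.exists_extendsAlongLine {n m : ℕ} {X : Set (Fin n → ℝ)} {i : Fin n}
    (hX : Stable X i) {f : Jet X m → ℝ} (hf : IsSmooth X m f) (p : Jet X m) :
    ∃ φ, ExtendsAlongLine X m i f p φ ∧ HasDerivAt φ (totalDerivFun X m i f p) 0 := by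
  obtain ⟨s, F, hF, hf⟩ := hf
  set q : (Fin n → ℝ) × (s → ℝ) := (p.1, fun k => p.2 k) with hq
  set v : (Fin n → ℝ) × (s → ℝ) := (Pi.single i 1, fun k => p.2 (k.1.1, k.1.2 + unitIdx i)) with hv
  have hline : HasDerivAt (fun t : ℝ => q + t • v) v 0 := by
    simpa using ((hasDerivAt_id (0 : ℝ)).smul_const v).const_add q
  have hd : HasDerivAt (fun t : ℝ => F (q + t • v)) (fderiv ℝ F q v) 0 := by
    have h1 : HasFDerivAt F (fderiv ℝ F q) (q + (0 : ℝ) • v) := by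
      simpa using (hF.differentiable (by simp) q).hasFDerivAt
    exact h1.comp_hasDerivAt (0 : ℝ) hline
  have he : ExtendsAlongLine X m i f p fun t => F (q + t • v) := fun t ht => by
    rw [hf]
    rfl
  exact ⟨_, he, by rwa [he.totalDerivFun_eq hX hd]⟩

theorem totalDeriv_mul {n m : ℕ} {X : Set (Fin n → ℝ)} {i : Fin n} (hX : Stable X i)
    (f g : smoothFun X m) :
    totalDeriv X m i hX (f * g) = totalDeriv X m i hX f * g + f * totalDeriv X m i hX g := by
  apply Subtype.ext
  funext p
  obtain ⟨φ, hφ, hφ'⟩ := IsSmooth.exists_extendsAlongLine hX f.2 p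
  obtain ⟨ψ, hψ, hψ'⟩ := IsSmooth.exists_extendsAlongLine hX g.2 p
  have h : ExtendsAlongLine X m i (f * g).1 p (φ * ψ) := fun t ht =>
    congrArg₂ (· * ·) (hφ t ht) (hψ t ht)
  refine (h.totalDerivFun_eq hX (hφ'.mul hψ')).trans ?_
  rw [hφ.apply_zero, hψ.apply_zero]
  rfl

/-- The iterated total derivative `D_{x_i} D_{x_j}` in terms of the second derivative of a
representing function: a form in which the symmetry in `i` and `j` is visible. -/
theorem totalDerivFun_totalDerivFun {n m : ℕ} {X : Set (Fin n → ℝ)} {i j : Fin n}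
    (hi : Stable X i) (hj : Stable X j) {f : Jet X m → ℝ} {s : Finset (Fin m × MIdx n)}
    {F : (Fin n → ℝ) × (s → ℝ) → ℝ} (hF : ContDiff ℝ ∞ F)
    (hf : ∀ p : Jet X m, f p = F (p.1, fun k => p.2 k)) (p : Jet X m) :
    totalDerivFun X m i (totalDerivFun X m j f) p =
      fderiv ℝ (fderiv ℝ F) (p.1, fun k => p.2 k)
        (Pi.single i 1, fun k => p.2 (k.1.1, k.1.2 + unitIdx i))
        (Pi.single j 1, fun k => p.2 (k.1.1, k.1.2 + unitIdx j)) +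
      fderiv ℝ F (p.1, fun k => p.2 k)
        (0, fun k => p.2 (k.1.1, k.1.2 + unitIdx j + unitIdx i)) := by
  set q : (Fin n → ℝ) × (s → ℝ) := (p.1, fun k => p.2 k) with hq
  set v : (Fin n → ℝ) × (s → ℝ) := (Pi.single i 1, fun k => p.2 (k.1.1, k.1.2 + unitIdx i)) with hv
  set w : (Fin n → ℝ) × (s → ℝ) := (Pi.single j 1, fun k => p.2 (k.1.1, k.1.2 + unitIdx j)) with hw
  set z : (Fin n → ℝ) × (s → ℝ) :=
    (0, fun k => p.2 (k.1.1, k.1.2 + unitIdx j + unitIdx i)) with hz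
  have hline (a b : (Fin n → ℝ) × (s → ℝ)) : HasDerivAt (fun t : ℝ => a + t • b) b 0 := by
    simpa using ((hasDerivAt_id (0 : ℝ)).smul_const b).const_add a
  have hF' : ContDiff ℝ ∞ (fderiv ℝ F) := hF.fderiv_right (by simp)
  have h1 : HasDerivAt (fun t : ℝ => fderiv ℝ F (q + t • v)) (fderiv ℝ (fderiv ℝ F) q v) 0 := by
    have h1 : HasFDerivAt (fderiv ℝ F) (fderiv ℝ (fderiv ℝ F) q) (q + (0 : ℝ) • v) := by
      simpa using (hF'.differentiable (by simp) q).hasFDerivAt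
    exact h1.comp_hasDerivAt (0 : ℝ) (hline q v)
  have h2 := h1.clm_apply (hline w z)
  simp only [zero_smul, add_zero] at h2
  refine ExtendsAlongLine.totalDerivFun_eq hi (fun t ht => ?_) h2
  rw [totalDerivFun_eq hj hF hf]
  congr 1
  ext <;> simp [w, z]

theorem totalDeriv_comm {n m : ℕ} {X : Set (Fin n → ℝ)} {i j : Fin n} (hi : Stable X i)
    (hj : Stable X j) (f : smoothFun X m) :
    totalDeriv X m i hi (totalDeriv X m j hj f) = totalDeriv X m j hj (totalDeriv X m i hi f) := by
  apply Subtype.ext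
  funext p
  obtain ⟨s, F, hF, hf⟩ := f.2
  refine (totalDerivFun_totalDerivFun hi hj hF hf p).trans
    (Eq.trans ?_ (totalDerivFun_totalDerivFun hj hi hF hf p).symm)
  have hsymm := (hF.contDiffAt (x := ((p.1 : Fin n → ℝ), fun k : s => p.2 k))).isSymmSndFDerivAt
    (by simpa using WithTop.coe_le_coe.2 (le_top : (2 : ℕ∞) ≤ ⊤))
  rw [hsymm.eq]
  simp only [add_right_comm _ (unitIdx i) (unitIdx j)]

/-! ### The algebras `C^∞(G)` and `C^∞(∂G)` -/

theorem D_mul {d m : ℕ} (i : Fin (d + 1)) (f g : FunG d m) :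
    D d m i (f * g) = D d m i f * g + f * D d m i g :=
  totalDeriv_mul (halfSpace_stable d i) f g

theorem D_commute {d m : ℕ} (i j : Fin (d + 1)) :
    Commute (D d m i : Module.End ℝ (FunG d m)) (D d m j) :=
  LinearMap.ext fun f => totalDeriv_comm (halfSpace_stable d i) (halfSpace_stable d j) f

theorem DBd_commute {d m : ℕ} (i j : Fin d) :
    Commute (DBd d m i : Module.End ℝ (FunBd d m)) (DBd d m j) :=
  LinearMap.ext fun f => totalDeriv_comm (hyperplane_stable d i) (hyperplane_stable d j) f

/-- The restriction to `∂G` as an algebra homomorphism. -/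
def resHom (d m : ℕ) : FunG d m →ₐ[ℝ] FunBd d m where
  toFun := res d m
  map_one' := rfl
  map_mul' _ _ := rfl
  map_zero' := rfl
  map_add' _ _ := rfl
  commutes' _ := rfl

@[simp] theorem resHom_apply {d m : ℕ} (f : FunG d m) : resHom d m f = res d m f := rfl

@[simp] theorem res_zero (d m : ℕ) : res d m 0 = 0 := rfl

/-- A smooth function on `∂G` is by definition the restriction of a smooth function of all the
variables, so that no extension theorem is needed. -/
theorem res_surjective (d m : ℕ) : Function.Surjective (res d m) := by
  rintro ⟨g, s, F, hF, hg⟩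
  refine ⟨⟨fun p => F (p.1, fun k => p.2 k), s, F, hF, fun _ => rfl⟩, Subtype.ext ?_⟩
  funext p
  exact (hg p).symm

/-- The total derivatives tangent to the boundary commute with the restriction. -/
theorem res_D_castSucc {d m : ℕ} (i : Fin d) (f : FunG d m) :
    res d m (D d m i.castSucc f) = DBd d m i (res d m f) := by
  apply Subtype.ext
  funext p
  obtain ⟨φ, hφ, hφ'⟩ :=
    IsSmooth.exists_extendsAlongLine (halfSpace_stable d i.castSucc) f.2 (inclBd d m p)
  have h : ExtendsAlongLine (hyperplane d) m i.castSucc (res d m f).1 p φ := fun t ht =>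
    hφ t (ge_of_eq ht)
  exact (h.totalDerivFun_eq (hyperplane_stable d i) hφ').symm

/-- The function `exp (∑ μ_i x_i)`. -/
def expFun (d m : ℕ) (μ : Fin (d + 1) → ℝ) : FunG d m :=
  ⟨fun p => Real.exp (∑ i, μ i * (p.1 : Fin (d + 1) → ℝ) i), ∅,
    fun q => Real.exp (∑ i, μ i * q.1 i), by fun_prop, fun _ => rfl⟩

theorem D_expFun {d m : ℕ} (μ : Fin (d + 1) → ℝ) (i : Fin (d + 1)) :
    D d m i (expFun d m μ) = μ i • expFun d m μ := by
  apply Subtype.ext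
  funext p
  have h : ExtendsAlongLine (halfSpace d) m i (expFun d m μ).1 p
      fun t => Real.exp (∑ k, μ k * (p.1 : Fin (d + 1) → ℝ) k + t * μ i) := fun t ht => by
    simp [expFun, mul_add, Finset.sum_add_distrib, Pi.single_apply, mul_comm]
  refine h.totalDerivFun_eq (φ' := μ i * Real.exp (∑ k, μ k * (p.1 : Fin (d + 1) → ℝ) k))
    (halfSpace_stable d i) ?_
  have := (((hasDerivAt_id (0 : ℝ)).mul_const (μ i)).const_add
    (∑ k, μ k * (p.1 : Fin (d + 1) → ℝ) k)).exp
  simpa [mul_comm] using this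

/-! ### Iterated total derivatives -/

/-- For pairwise commuting elements, the ordered product of powers behaves as a monomial. -/
theorem prod_ofFn_pow_add_unitIdx {M : Type*} [Monoid M] {n : ℕ} (f : Fin n → M)
    (hf : ∀ i j, Commute (f i) (f j)) (I : MIdx n) (i : Fin n) :
    (List.ofFn fun k => f k ^ (I + unitIdx i) k).prod =
      f i * (List.ofFn fun k => f k ^ I k).prod := by
  induction n with
  | zero => exact i.elim0
  | succ n ih =>
    rw [List.ofFn_succ, List.ofFn_succ, List.prod_cons, List.prod_cons]
    refine Fin.cases ?_ (fun i => ?_) i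
    · simp [unitIdx, pow_succ', mul_assoc]
    · have h := ih (fun k => f k.succ) (fun _ _ => hf _ _) (fun k => I k.succ) i
      have e : (fun k : Fin n => f k.succ ^ (I + unitIdx i.succ) k.succ) =
          fun k => f k.succ ^ ((fun k => I k.succ) + unitIdx i : MIdx n) k := by
        funext k
        simp [unitIdx, Pi.single_apply]
      rw [e, h]
      simp only [← mul_assoc]
      congr 1
      simpa [unitIdx] using ((hf i.succ 0).pow_right (I 0)).eq.symm

/-- Multi-indices are generated by the unit multi-indices. -/
theorem MIdx.induction {n : ℕ} {motive : MIdx n → Prop} (zero : motive 0)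
    (add : ∀ I i, motive I → motive (I + unitIdx i)) (I : MIdx n) : motive I := by
  induction hs : ∑ i, I i generalizing I with
  | zero =>
    have : I = 0 := by
      funext i
      simpa using (Finset.sum_eq_zero_iff.1 hs) i
    exact this ▸ zero
  | succ s ih =>
    obtain ⟨i, -, hi⟩ : ∃ i ∈ Finset.univ, I i ≠ 0 :=
      Finset.exists_ne_zero_of_sum_ne_zero (by omega)
    have e : I - unitIdx i + unitIdx i = I := by
      funext k
      rcases eq_or_ne k i with rfl | h
      · simp [unitIdx]; omega
      · simp [unitIdx, h]
    rw [← e]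
    refine add _ _ (ih _ ?_)
    have h2 : ∑ k, (I - unitIdx i + unitIdx i) k = s + 1 := by rw [e, hs]
    simp only [Pi.add_apply, Finset.sum_add_distrib] at h2
    simpa [unitIdx] using h2

@[simp] theorem DI_zero (d m : ℕ) : DI d m 0 = LinearMap.id := by
  simp only [DI, Pi.zero_apply, pow_zero, List.ofFn_const, List.prod_replicate, one_pow]
  rfl

@[simp] theorem DIBd_zero (d m : ℕ) : DIBd d m 0 = LinearMap.id := by
  simp only [DIBd, Pi.zero_apply, pow_zero, List.ofFn_const, List.prod_replicate, one_pow]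
  rfl

theorem DI_add_unitIdx {d m : ℕ} (I : MIdx (d + 1)) (i : Fin (d + 1)) (f : FunG d m) :
    DI d m (I + unitIdx i) f = D d m i (DI d m I f) :=
  LinearMap.congr_fun (prod_ofFn_pow_add_unitIdx (D d m) D_commute I i) f

theorem DIBd_add_unitIdx {d m : ℕ} (J : MIdx d) (i : Fin d) (f : FunBd d m) :
    DIBd d m (J + unitIdx i) f = DBd d m i (DIBd d m J f) :=
  LinearMap.congr_fun (prod_ofFn_pow_add_unitIdx (DBd d m) DBd_commute J i) f

theorem DI_D {d m : ℕ} (I : MIdx (d + 1)) (i : Fin (d + 1)) (f : FunG d m) :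
    DI d m I (D d m i f) = D d m i (DI d m I f) := by
  induction I using MIdx.induction with
  | zero => simp
  | add I k ih =>
    rw [DI_add_unitIdx, DI_add_unitIdx, ih]
    exact LinearMap.congr_fun (D_commute k i).eq _

theorem DIBd_DBd {d m : ℕ} (J : MIdx d) (i : Fin d) (f : FunBd d m) :
    DIBd d m J (DBd d m i f) = DBd d m i (DIBd d m J f) := by
  induction J using MIdx.induction with
  | zero => simp
  | add I k ih =>
    rw [DIBd_add_unitIdx, DIBd_add_unitIdx, ih]
    exact LinearMap.congr_fun (DBd_commute k i).eq _

theorem DI_expFun {d m : ℕ} (μ : Fin (d + 1) → ℝ) (I : MIdx (d + 1)) :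
    DI d m I (expFun d m μ) = (∏ i, μ i ^ I i) • expFun d m μ := by
  induction I using MIdx.induction with
  | zero => simp
  | add I k ih =>
    rw [DI_add_unitIdx, ih, map_smul, D_expFun, smul_smul]
    simp only [Pi.add_apply, pow_add, Finset.prod_mul_distrib, unitIdx, Pi.single_apply, pow_ite,
      pow_one, pow_zero, Finset.prod_ite_eq', Finset.mem_univ, if_true]

/-! ### Coordinates of `𝒞`-differential operators -/

/-- The scalar-valued operator `∑ a_j^I D_I^{(j)}` with coefficients `a`. -/
def opOf (d m : ℕ) : Coeffs d m →ₗ[ℝ] Kappa d m →ₗ[ℝ] FunG d m :=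
  Finsupp.lsum ℝ fun k =>
    { toFun := fun c => LinearMap.mulLeft ℝ c ∘ₗ DIj d m k
      map_add' := fun a b => LinearMap.ext fun _ => add_mul a b _
      map_smul' := fun r a => LinearMap.ext fun _ => smul_mul_assoc r a _ }

theorem opOf_single {d m : ℕ} (k : Fin m × MIdx (d + 1)) (c : FunG d m) (f : Kappa d m) :
    opOf d m (Finsupp.single k c) f = c * DI d m k.2 (f k.1) := by
  simp [opOf, DIj]

/-- The operator `f ↦ (∑ a_j^I D_I^{(j)} f) θ`. -/
def opForm (d m : ℕ) {k : ℕ} (θ : HForm d m k) :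
    Coeffs d m →ₗ[ℝ] Kappa d m →ₗ[ℝ] HForm d m k :=
  LinearMap.compRight ℝ
    ((LinearMap.toSpanSingleton (FunG d m) (HForm d m k) θ).restrictScalars ℝ) ∘ₗ opOf d m

theorem opForm_apply {d m k : ℕ} (θ : HForm d m k) (a : Coeffs d m) (f : Kappa d m) :
    opForm d m θ a f = opOf d m a f • θ := rfl

theorem coordOp_eq_opForm {d m : ℕ} (a : Coeffs d m) : coordOp d m a = opForm d m (vol d m) a :=
  rfl

/-- `T_i a` are the coefficients of the composition `D_{x_i} ∘ ∑ a_j^I D_I^{(j)}`. -/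
def derivCoeffs (d m : ℕ) (i : Fin (d + 1)) : Coeffs d m →ₗ[ℝ] Coeffs d m :=
  Finsupp.lsum ℝ fun k =>
    Finsupp.lsingle k ∘ₗ D d m i + Finsupp.lsingle (k.1, k.2 + unitIdx i)

theorem derivCoeffs_single {d m : ℕ} (i : Fin (d + 1)) (k : Fin m × MIdx (d + 1)) (c : FunG d m) :
    derivCoeffs d m i (Finsupp.single k c) =
      Finsupp.single k (D d m i c) + Finsupp.single (k.1, k.2 + unitIdx i) c := by
  simp [derivCoeffs]

theorem opOf_derivCoeffs {d m : ℕ} (i : Fin (d + 1)) (a : Coeffs d m) (f : Kappa d m) :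
    opOf d m (derivCoeffs d m i a) f = D d m i (opOf d m a f) := by
  induction a using Finsupp.induction_linear with
  | zero => simp
  | add a b ha hb => simp only [map_add, LinearMap.add_apply, ha, hb]
  | single k c =>
    rw [derivCoeffs_single, map_add, LinearMap.add_apply]
    simp only [opOf_single, D_mul, DI_add_unitIdx]

theorem opOf_smul {d m : ℕ} (c : FunG d m) (a : Coeffs d m) (f : Kappa d m) :
    opOf d m (c • a) f = c * opOf d m a f := by
  induction a using Finsupp.induction_linear with
  | zero => simp
  | add a b ha hb => simp only [smul_add, map_add, LinearMap.add_apply, ha, hb, mul_add]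
  | single k b => simp only [Finsupp.smul_single, smul_eq_mul, opOf_single, mul_assoc]

/-- Compositions of scalar `𝒞`-differential operators with operators in coordinates can be
written in coordinates, by the Leibniz rule. -/
theorem exists_opOf_eq_comp {d m : ℕ} {B : Module.End ℝ (FunG d m)} (hB : B ∈ scalarCDiff d m)
    (a : Coeffs d m) : ∃ b, ∀ f, opOf d m b f = B (opOf d m a f) := by
  induction hB using Algebra.adjoin_induction generalizing a with
  | mem B hB =>
    rcases hB with ⟨c, rfl⟩ | ⟨i, rfl⟩
    · exact ⟨c • a, fun f => opOf_smul c a f⟩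
    · exact ⟨derivCoeffs d m i a, fun f => opOf_derivCoeffs i a f⟩
  | algebraMap r => exact ⟨r • a, fun f => by simp⟩
  | add B C _ _ hB hC =>
    obtain ⟨b, hb⟩ := hB a
    obtain ⟨c, hc⟩ := hC a
    exact ⟨b + c, fun f => by simp only [map_add, LinearMap.add_apply, hb, hc]⟩
  | mul B C _ _ hB hC =>
    obtain ⟨c, hc⟩ := hC a
    obtain ⟨b, hb⟩ := hB c
    exact ⟨b, fun f => by rw [hb, hc]; rfl⟩

theorem exists_opOf_eq_comp_dual {d m : ℕ} {B : Module.End ℝ (FunG d m)}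
    (hB : B ∈ scalarCDiff d m) (φ : Kappa d m →ₗ[FunG d m] FunG d m) :
    ∃ b, ∀ f, opOf d m b f = B (φ f) := by
  classical
  obtain ⟨b, hb⟩ := exists_opOf_eq_comp hB
    (∑ j, Finsupp.single (j, (0 : MIdx (d + 1))) (φ fun i => if j = i then 1 else 0))
  refine ⟨b, fun f => ?_⟩
  rw [hb, LinearMap.pi_apply_eq_sum_univ φ f]
  simp only [map_sum, LinearMap.sum_apply, opOf_single, DI_zero, LinearMap.id_apply, smul_eq_mul,
    mul_comm]

theorem DI_mem_scalarCDiff {d m : ℕ} (I : MIdx (d + 1)) :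
    (DI d m I : Module.End ℝ (FunG d m)) ∈ scalarCDiff d m := by
  refine Subalgebra.list_prod_mem _ fun B hB => ?_
  obtain ⟨i, rfl⟩ := List.mem_ofFn.1 hB
  have h : (D d m i : Module.End ℝ (FunG d m)) ∈ scalarCDiff d m :=
    Algebra.subset_adjoin (Or.inr ⟨i, rfl⟩)
  exact pow_mem h (I i)

theorem opForm_mem_CDiff {d m k : ℕ} (θ : HForm d m k) (a : Coeffs d m) :
    opForm d m θ a ∈ CDiff d m (Kappa d m) (HForm d m k) := by
  induction a using Finsupp.induction_linear with
  | zero => simp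
  | add a b ha hb => rw [map_add]; exact add_mem ha hb
  | single k c =>
    refine Submodule.subset_span ⟨DI d m k.2, DI_mem_scalarCDiff _, LinearMap.proj k.1, c • θ,
      fun f => ?_⟩
    rw [opForm_apply, opOf_single, smul_smul, mul_comm]
    rfl

theorem opOf_mem_CDiff {d m : ℕ} (a : Coeffs d m) :
    opOf d m a ∈ CDiff d m (Kappa d m) (FunG d m) := by
  induction a using Finsupp.induction_linear with
  | zero => simp
  | add a b ha hb => rw [map_add]; exact add_mem ha hb
  | single k c =>
    refine Submodule.subset_span ⟨DI d m k.2, DI_mem_scalarCDiff _, LinearMap.proj k.1, c,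
      fun f => ?_⟩
    rw [opOf_single, mul_comm]
    rfl

theorem exists_opOf_of_mem_CDiff {d m : ℕ} {Δ : Kappa d m →ₗ[ℝ] FunG d m}
    (hΔ : Δ ∈ CDiff d m (Kappa d m) (FunG d m)) : ∃ a, opOf d m a = Δ := by
  suffices h : CDiff d m (Kappa d m) (FunG d m) ≤ LinearMap.range (opOf d m) from h hΔ
  refine Submodule.span_le.2 ?_
  rintro Δ ⟨B, hB, φ, q, h⟩
  obtain ⟨b, hb⟩ := exists_opOf_eq_comp_dual hB φ
  refine ⟨q • b, LinearMap.ext fun f => ?_⟩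
  rw [opOf_smul, hb, h, smul_eq_mul, mul_comm]

theorem eq_smul_vol {d m : ℕ} (θ : HForm d m (d + 1)) :
    θ = θ ⟨Finset.univ, by simp⟩ • vol d m := by
  funext S
  obtain ⟨S, hS⟩ := S
  obtain rfl : S = Finset.univ := (Finset.card_eq_iff_eq_univ S).1 (by simpa using hS)
  simp [vol]

theorem mem_TopOps_iff {d m : ℕ} {B : Kappa d m →ₗ[ℝ] HForm d m (d + 1)} :
    B ∈ TopOps d m ↔ ∃ a, coordOp d m a = B := by
  refine ⟨fun hB => ?_, ?_⟩
  · suffices h : TopOps d m ≤ LinearMap.range (opForm d m (vol d m)) from h hB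
    refine Submodule.span_le.2 ?_
    rintro Δ ⟨B, hB, φ, q, h⟩
    obtain ⟨b, hb⟩ := exists_opOf_eq_comp_dual hB φ
    refine ⟨q ⟨Finset.univ, by simp⟩ • b, LinearMap.ext fun f => ?_⟩
    rw [opForm_apply, opOf_smul, hb, h, mul_comm, mul_smul, ← eq_smul_vol]
  · rintro ⟨a, rfl⟩
    exact opForm_mem_CDiff _ a

/-- The value of an operator at an exponential function of the `j`-th component. -/
theorem opOf_single_expFun {d m : ℕ} (a : Coeffs d m) (j : Fin m) (μ : Fin (d + 1) → ℝ) :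
    opOf d m a (Pi.single j (expFun d m μ)) =
      (a.sum fun k c => if k.1 = j then (∏ i, μ i ^ k.2 i) • c else 0) * expFun d m μ := by
  induction a using Finsupp.induction_linear with
  | zero => simp
  | add a b ha hb =>
    rw [map_add, LinearMap.add_apply, ha, hb, Finsupp.sum_add_index' (by simp), add_mul]
    intro k c c'
    split_ifs <;> simp
  | single k c =>
    rw [opOf_single, Finsupp.sum_single_index (by simp)]
    by_cases h : k.1 = j
    · subst h
      rw [Pi.single_eq_same, DI_expFun, if_pos rfl, mul_smul_comm, smul_mul_assoc]
    · rw [Pi.single_eq_of_ne h, if_neg h]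
      simp

/-- The coefficients of an operator are determined by the operator: its values at the functions
`exp (∑ μ_i x_i)` give, at each point, a polynomial in `μ` with these coefficients. -/
theorem opOf_injective (d m : ℕ) : Function.Injective (opOf d m) := by
  classical
  refine (injective_iff_map_eq_zero _).2 fun a ha => Finsupp.ext fun k => Subtype.ext (funext
    fun p => ?_)
  obtain ⟨j, I⟩ := k
  let P : MvPolynomial (Fin (d + 1)) ℝ := a.sum fun k c =>
    if k.1 = j then MvPolynomial.monomial (Finsupp.equivFunOnFinite.symm k.2) (c.1 p) else 0
  have hP : P = 0 := MvPolynomial.funext fun μ => by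
    have h := opOf_single_expFun a j μ
    rw [ha] at h
    have h' := congrArg (fun f : FunG d m => f.1 p) h.symm
    have h0 : (a.sum fun k c => if k.1 = j then (∏ i, μ i ^ k.2 i) • c else 0).1 p = 0 :=
      (mul_eq_zero.1 h').resolve_right (Real.exp_ne_zero _)
    let ev : FunG d m →+ ℝ := ⟨⟨fun f => f.1 p, rfl⟩, fun _ _ => rfl⟩
    change ev _ = 0 at h0
    rw [Finsupp.sum, map_sum] at h0
    rw [map_zero, ← h0]
    simp only [P, Finsupp.sum, map_sum]
    refine Finset.sum_congr rfl fun k _ => ?_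
    split_ifs
    · rw [MvPolynomial.eval_monomial, Finsupp.prod_fintype _ _ (by simp), mul_comm]
      rfl
    · simp
  have h := congrArg (MvPolynomial.coeff (Finsupp.equivFunOnFinite.symm I)) hP
  simp only [P, Finsupp.sum, MvPolynomial.coeff_sum] at h
  rw [MvPolynomial.coeff_zero, Finset.sum_eq_single (j, I)] at h
  · simp only [if_true, MvPolynomial.coeff_monomial] at h
    exact h
  · rintro ⟨j', I'⟩ _ hne
    dsimp only
    split_ifs with hj
    · rw [MvPolynomial.coeff_monomial, if_neg]
      intro e
      exact hne (Prod.ext hj (Finsupp.equivFunOnFinite.symm.injective e))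
    · simp
  · intro hk
    rw [Finsupp.notMem_support_iff.1 hk]
    simp only [if_true, MvPolynomial.coeff_monomial]
    rfl

theorem coordOp_injective (d m : ℕ) : Function.Injective (coordOp d m) := by
  intro a b h
  refine opOf_injective d m (LinearMap.ext fun f => ?_)
  have h' := congrFun (LinearMap.congr_fun h f) ⟨Finset.univ, by simp⟩
  simpa [coordOp_eq_opForm, opForm_apply, vol] using h'

/-! ### Horizontal forms -/

/-- The coefficient `θ_S` of a horizontal `k`-form, set to zero unless `S` has `k` elements. -/
def HForm.coeff {d m k : ℕ} (θ : HForm d m k) (S : Finset (Fin (d + 1))) : FunG d m :=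
  if h : S.card = k then θ ⟨S, h⟩ else 0

theorem HForm.coeff_of_card {d m k : ℕ} (θ : HForm d m k) {S : Finset (Fin (d + 1))}
    (h : S.card = k) : θ.coeff S = θ ⟨S, h⟩ := dif_pos h

/-- The sign of `dx_i ∧ dx_{T ∖ i}` relative to `dx_T`, for `i ∈ T`. -/
def wedgeSign {d : ℕ} (i : Fin (d + 1)) (T : Finset (Fin (d + 1))) : ℝ :=
  (-1) ^ (T.filter (· < i)).card

theorem wedgeSign_mul_self {d : ℕ} (i : Fin (d + 1)) (T : Finset (Fin (d + 1))) :
    wedgeSign i T * wedgeSign i T = 1 := by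
  rw [wedgeSign, ← mul_pow]
  norm_num

theorem wedgeSign_erase {d : ℕ} {i j : Fin (d + 1)} {T : Finset (Fin (d + 1))} (hi : i ∈ T)
    (h : i < j) : wedgeSign j (T.erase i) = -wedgeSign j T := by
  have e : (T.erase i).filter (· < j) = (T.filter (· < j)).erase i := Finset.filter_erase _ _ _
  have hm : i ∈ T.filter (· < j) := Finset.mem_filter.2 ⟨hi, h⟩
  rw [wedgeSign, wedgeSign, e, ← Finset.card_erase_add_one hm, pow_succ]
  ring

theorem wedgeSign_erase_of_le {d : ℕ} {i j : Fin (d + 1)} {T : Finset (Fin (d + 1))}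
    (h : j ≤ i) : wedgeSign j (T.erase i) = wedgeSign j T := by
  have e : (T.erase i).filter (· < j) = T.filter (· < j) := by
    rw [Finset.filter_erase, Finset.erase_eq_of_notMem]
    simp [h]
  rw [wedgeSign, wedgeSign, e]

/-- The signs of `dx_i ∧ dx_j` and of `dx_j ∧ dx_i` are opposite. -/
theorem wedgeSign_mul_erase {d : ℕ} {i j : Fin (d + 1)} {T : Finset (Fin (d + 1))} (hi : i ∈ T)
    (hj : j ∈ T) (h : i ≠ j) : wedgeSign i T * wedgeSign j (T.erase i) =
      -(wedgeSign j T * wedgeSign i (T.erase j)) := by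
  rcases h.lt_or_gt with h | h
  · rw [wedgeSign_erase hi h, wedgeSign_erase_of_le h.le]
    ring
  · rw [wedgeSign_erase hj h, wedgeSign_erase_of_le h.le]
    ring

theorem dh_apply {d m k : ℕ} (θ : HForm d m k)
    (T : {S : Finset (Fin (d + 1)) // S.card = k + 1}) :
    dh d m k θ T = ∑ i ∈ T.1, wedgeSign i T.1 • D d m i (θ.coeff (T.1.erase i)) := by
  rw [← Finset.sum_coe_sort T.1]
  simp only [dh, LinearMap.pi_apply, LinearMap.sum_apply, LinearMap.smul_apply,
    LinearMap.comp_apply, LinearMap.proj_apply]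
  refine Finset.sum_congr rfl fun i _ => ?_
  rw [HForm.coeff_of_card]
  rfl

theorem dh_dh {d m k : ℕ} (θ : HForm d m k) : dh d m (k + 1) (dh d m k θ) = 0 := by
  funext T
  have h : ∀ i ∈ T.1, wedgeSign i T.1 • D d m i ((dh d m k θ).coeff (T.1.erase i)) =
      ∑ j ∈ T.1.erase i, (wedgeSign i T.1 * wedgeSign j (T.1.erase i)) •
        D d m i (D d m j (θ.coeff ((T.1.erase i).erase j))) := fun i hi => by
    rw [HForm.coeff_of_card _ (by rw [Finset.card_erase_of_mem hi, T.2]; rfl), dh_apply, map_sum,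
      Finset.smul_sum]
    simp only [map_smul, smul_smul]
  rw [dh_apply, Finset.sum_congr rfl h, Finset.sum_sigma']
  refine Finset.sum_involution (fun p _ => ⟨p.2, p.1⟩) ?_ ?_ ?_ ?_
  · rintro ⟨i, j⟩ hp
    obtain ⟨hi, hj⟩ := Finset.mem_sigma.1 hp
    obtain ⟨hne, hj⟩ := Finset.mem_erase.1 hj
    have hc := LinearMap.congr_fun (D_commute (m := m) i j).eq (θ.coeff ((T.1.erase i).erase j))
    rw [Module.End.mul_apply, Module.End.mul_apply] at hc
    dsimp only at hi hj hne ⊢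
    rw [wedgeSign_mul_erase hi hj hne.symm, Finset.erase_right_comm (a := j), neg_smul,
      neg_add_eq_zero]
    exact congrArg (fun g => _ • g) hc
  · rintro ⟨i, j⟩ hp _ e
    exact (Finset.mem_erase.1 (Finset.mem_sigma.1 hp).2).1 (congrArg Sigma.fst e)
  · rintro ⟨i, j⟩ hp
    obtain ⟨hi, hj⟩ := Finset.mem_sigma.1 hp
    obtain ⟨hne, hj⟩ := Finset.mem_erase.1 hj
    exact Finset.mem_sigma.2 ⟨hj, Finset.mem_erase.2 ⟨hne.symm, hi⟩⟩
  · intro _ _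
    rfl

/-- The form `dx_i ∧ θ`. -/
def wedgeDx {d m k : ℕ} (i : Fin (d + 1)) (θ : HForm d m k) : HForm d m (k + 1) := fun T =>
  if i ∈ T.1 then wedgeSign i T.1 • θ.coeff (T.1.erase i) else 0

theorem dh_smul {d m k : ℕ} (f : FunG d m) (θ : HForm d m k) :
    dh d m k (f • θ) = (∑ i, D d m i f • wedgeDx i θ) + f • dh d m k θ := by
  funext T
  have h : ∀ S, (f • θ).coeff S = f * θ.coeff S := fun S => by
    by_cases hS : S.card = k <;> simp [HForm.coeff, hS]
  simp only [Pi.add_apply, Finset.sum_apply, Pi.smul_apply, dh_apply, h, D_mul, smul_add,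
    Finset.sum_add_distrib, wedgeDx, smul_eq_mul, mul_ite, mul_zero, Finset.mul_sum, mul_smul_comm]
  congr 1
  rw [← Finset.sum_filter, Finset.filter_univ_mem]

theorem mem_relForm_iff {d m k : ℕ} {θ : HForm d m k} :
    θ ∈ relForm d m k ↔ ∀ S : Finset (Fin d), res d m (θ.coeff (S.map Fin.castSuccEmb)) = 0 := by
  refine ⟨fun h S => ?_, fun h => funext fun S => ?_⟩
  · by_cases hS : S.card = k
    · rw [HForm.coeff_of_card _ (by rw [Finset.card_map, hS])]
      exact congrFun h ⟨S, hS⟩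
    · rw [HForm.coeff, dif_neg (by rwa [Finset.card_map]), res_zero]
  · have := h S.1
    rwa [HForm.coeff_of_card _ (by rw [Finset.card_map, S.2])] at this

theorem map_castSuccEmb_erase {d : ℕ} (S : Finset (Fin d)) (i : Fin d) :
    (S.map Fin.castSuccEmb).erase i.castSucc = (S.erase i).map Fin.castSuccEmb := by
  simp

theorem res_smul {d m : ℕ} (r : ℝ) (f : FunG d m) : res d m (r • f) = r • res d m f := rfl

theorem wedgeDx_mem_relForm {d m k : ℕ} (i : Fin (d + 1)) {θ : HForm d m k}
    (hθ : θ ∈ relForm d m k) : wedgeDx i θ ∈ relForm d m (k + 1) := by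
  rw [mem_relForm_iff] at hθ
  funext S
  change res d m (if i ∈ S.1.map Fin.castSuccEmb then _ else 0) = 0
  split_ifs with h
  · obtain ⟨i, _, rfl⟩ := Finset.mem_map.1 h
    rw [res_smul, Fin.coe_castSuccEmb, map_castSuccEmb_erase, hθ, smul_zero]
  · rfl

theorem dh_mem_relForm {d m k : ℕ} {θ : HForm d m k} (hθ : θ ∈ relForm d m k) :
    dh d m k θ ∈ relForm d m (k + 1) := by
  rw [mem_relForm_iff] at hθ
  funext S
  change resHom d m (dh d m k θ _) = 0
  rw [dh_apply, map_sum, Finset.sum_map]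
  refine Finset.sum_eq_zero fun i _ => ?_
  rw [map_smul, resHom_apply, Fin.coe_castSuccEmb, res_D_castSucc, map_castSuccEmb_erase, hθ,
    map_zero, smul_zero]

/-! ### The relative Spencer complex -/

theorem spencer_apply {d m k : ℕ} (Θ : Kappa d m →ₗ[ℝ] HForm d m k) (f : Kappa d m) :
    spencer d m k Θ f = dh d m k (Θ f) := rfl

theorem opForm_mem_relCochains {d m k : ℕ} {θ : HForm d m k} (hθ : θ ∈ relForm d m k)
    (a : Coeffs d m) : opForm d m θ a ∈ relCochains d m k :=
  Submodule.subset_span ⟨opOf d m a, opOf_mem_CDiff a, θ, hθ, fun _ => rfl⟩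

theorem relCochains_eq_span {d m k : ℕ} : relCochains d m k =
    Submodule.span ℝ {Θ | ∃ θ ∈ relForm d m k, ∃ a, opForm d m θ a = Θ} := by
  apply le_antisymm <;> refine Submodule.span_le.2 ?_
  · rintro Θ ⟨Δ, hΔ, θ, hθ, h⟩
    obtain ⟨a, rfl⟩ := exists_opOf_of_mem_CDiff hΔ
    exact Submodule.subset_span ⟨θ, hθ, a, (LinearMap.ext h).symm⟩
  · rintro _ ⟨θ, hθ, a, rfl⟩
    exact opForm_mem_relCochains hθ a

theorem relCochains_le_CDiff (d m k : ℕ) :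
    relCochains d m k ≤ CDiff d m (Kappa d m) (HForm d m k) := by
  rw [relCochains_eq_span, Submodule.span_le]
  rintro _ ⟨θ, _, a, rfl⟩
  exact opForm_mem_CDiff θ a

theorem map_spencer_relCochains_le (d m k : ℕ) :
    (relCochains d m k).map (spencer d m k) ≤ relCochains d m (k + 1) := by
  rw [relCochains_eq_span, Submodule.map_le_iff_le_comap, Submodule.span_le]
  rintro _ ⟨θ, hθ, a, rfl⟩
  have e : spencer d m k (opForm d m θ a) =
      (∑ i, opForm d m (wedgeDx i θ) (derivCoeffs d m i a)) + opForm d m (dh d m k θ) a := by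
    refine LinearMap.ext fun f => ?_
    simp only [spencer_apply, opForm_apply, dh_smul, LinearMap.add_apply, LinearMap.sum_apply,
      opOf_derivCoeffs]
  change spencer d m k (opForm d m θ a) ∈ relCochains d m (k + 1)
  rw [e]
  exact add_mem (sum_mem fun i _ => opForm_mem_relCochains (wedgeDx_mem_relForm i hθ) _)
    (opForm_mem_relCochains (dh_mem_relForm hθ) _)

theorem spencer_comp_spencer (d m k : ℕ) : spencer d m (k + 1) ∘ₗ spencer d m k = 0 :=
  LinearMap.ext fun Θ => LinearMap.ext fun f => dh_dh (Θ f)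

/-- In top degree every horizontal form is relative, because `∂G` has only `n - 1` independent
variables, and every horizontal form is closed. -/
theorem relCocycles_eq_TopOps (d m : ℕ) : relCocycles d m (d + 1) = TopOps d m := by
  refine le_antisymm (inf_le_left.trans (relCochains_le_CDiff d m _)) fun B hB => ?_
  obtain ⟨a, rfl⟩ := mem_TopOps_iff.1 hB
  refine ⟨opForm_mem_relCochains (funext fun S => ?_) a, LinearMap.mem_ker.2
    (LinearMap.ext fun f => funext fun T => ?_)⟩
  · have := S.1.card_le_univ
    rw [S.2, Fintype.card_fin] at this
    omega
  · have := T.1.card_le_univ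
    rw [T.2, Fintype.card_fin] at this
    omega

/-- The coboundaries of degree `n` in coordinates: the compositions `D_{x_i} ∘ Δ` with `i < n`
and the compositions `D_{x_n} ∘ Δ` where the coefficients of `Δ` vanish on `∂G`. -/
def coboundaryCoeffs (d m : ℕ) : Submodule ℝ (Coeffs d m) :=
  (⨆ i : Fin d, LinearMap.range (derivCoeffs d m i.castSucc)) ⊔
    (LinearMap.ker (Finsupp.mapRange.linearMap (resHom d m).toLinearMap)).map
      (derivCoeffs d m (Fin.last d))

theorem mem_coboundaryCoeffs_castSucc {d m : ℕ} (i : Fin d) (a : Coeffs d m) :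
    derivCoeffs d m i.castSucc a ∈ coboundaryCoeffs d m :=
  Submodule.mem_sup_left (Submodule.mem_iSup_of_mem i ⟨a, rfl⟩)

theorem mem_coboundaryCoeffs_last {d m : ℕ} {a : Coeffs d m}
    (ha : ∀ k, res d m (a k) = 0) : derivCoeffs d m (Fin.last d) a ∈ coboundaryCoeffs d m :=
  Submodule.mem_sup_right ⟨a, Finsupp.ext fun k => by simpa using ha k, rfl⟩

/-- The differential of a form of degree `n - 1`, in coordinates. -/
theorem spencer_opForm_eq_coordOp {d m : ℕ} (θ : HForm d m d) (a : Coeffs d m) :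
    spencer d m d (opForm d m θ a) = coordOp d m (∑ i, derivCoeffs d m i
      (wedgeSign i Finset.univ • θ.coeff (Finset.univ.erase i) • a)) := by
  refine LinearMap.ext fun f => ?_
  rw [spencer_apply, coordOp_eq_opForm, opForm_apply, eq_smul_vol (dh d m d _), dh_apply]
  congr 1
  rw [map_sum, LinearMap.sum_apply]
  refine Finset.sum_congr rfl fun i _ => ?_
  rw [opOf_derivCoeffs, map_smul, LinearMap.smul_apply, map_smul, opOf_smul,
    HForm.coeff_of_card _ (by simp), HForm.coeff_of_card _ (by simp), mul_comm]
  rfl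

/-- The form `g dx_i^`, normalized such that `dx_i ∧ dx_i^ = dx_1 ∧ ⋯ ∧ dx_n`, where `dx_i^`
omits `dx_i`. -/
def hatForm {d m : ℕ} (i : Fin (d + 1)) : HForm d m d := fun S =>
  if S.1 = Finset.univ.erase i then algebraMap ℝ _ (wedgeSign i Finset.univ) else 0

theorem spencer_opForm_hatForm {d m : ℕ} (i : Fin (d + 1)) (a : Coeffs d m) :
    spencer d m d (opForm d m (hatForm i) a) = coordOp d m (derivCoeffs d m i a) := by
  rw [spencer_opForm_eq_coordOp, Finset.sum_eq_single i]
  · rw [HForm.coeff_of_card _ (by simp), hatForm, if_pos rfl, algebraMap_smul, smul_smul,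
      wedgeSign_mul_self, one_smul]
  · intro j _ hj
    have hne : Finset.univ.erase j ≠ Finset.univ.erase i := fun e =>
      Finset.notMem_erase i _ (e ▸ Finset.mem_erase.2 ⟨hj.symm, Finset.mem_univ i⟩)
    rw [HForm.coeff_of_card _ (by simp), hatForm, if_neg hne, zero_smul, smul_zero, map_zero]
  · simp

theorem hatForm_mem_relForm {d m : ℕ} (i : Fin d) :
    (hatForm i.castSucc : HForm d m d) ∈ relForm d m d := by
  funext S
  change res d m (if S.1.map Fin.castSuccEmb = Finset.univ.erase i.castSucc then _ else 0) = 0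
  rw [if_neg, res_zero]
  intro e
  have : Fin.last d ∈ Finset.univ.erase i.castSucc :=
    Finset.mem_erase.2 ⟨(Fin.castSucc_lt_last i).ne', Finset.mem_univ _⟩
  rw [← e] at this
  obtain ⟨j, -, hj⟩ := Finset.mem_map.1 this
  exact (Fin.castSucc_lt_last j).ne hj

theorem coordOp_mem_relCoboundaries_iff {d m : ℕ} {a : Coeffs d m} :
    coordOp d m a ∈ relCoboundaries d m d ↔ a ∈ coboundaryCoeffs d m := by
  constructor
  · intro h
    have hle : relCoboundaries d m d ≤ (coboundaryCoeffs d m).map (opForm d m (vol d m)) := by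
      rw [relCoboundaries, relCochains_eq_span, Submodule.map_le_iff_le_comap, Submodule.span_le]
      rintro _ ⟨θ, hθ, a, rfl⟩
      refine ⟨_, ?_, (spencer_opForm_eq_coordOp θ a).symm⟩
      rw [Fin.sum_univ_castSucc]
      refine add_mem (sum_mem fun i _ => mem_coboundaryCoeffs_castSucc i _)
        (mem_coboundaryCoeffs_last fun k => ?_)
      have e : Finset.univ.erase (Fin.last d) = Finset.univ.map Fin.castSuccEmb := by
        rw [Fin.univ_castSuccEmb, Finset.erase_cons]
      have h0 := (mem_relForm_iff.1 hθ) Finset.univ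
      rw [← e] at h0
      rw [Finsupp.smul_apply, Finsupp.smul_apply, res_smul, smul_eq_mul, ← resHom_apply, map_mul,
        resHom_apply, h0, zero_mul, smul_zero]
    obtain ⟨b, hb, e⟩ := hle h
    rwa [← coordOp_injective d m e]
  · suffices h : coboundaryCoeffs d m ≤
        (relCoboundaries d m d).comap (opForm d m (vol d m)) from fun ha => h ha
    refine sup_le (iSup_le fun i => ?_) ?_
    · rintro _ ⟨a, rfl⟩
      exact ⟨_, opForm_mem_relCochains (hatForm_mem_relForm i) a, spencer_opForm_hatForm _ a⟩
    · rintro _ ⟨a, ha, rfl⟩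
      have ha' : ∀ k, res d m (a k) = 0 := fun k => by
        simpa using DFunLike.congr_fun (LinearMap.mem_ker.1 ha) k
      -- move the coefficients, which vanish on the boundary, from the operator to the form
      rw [← Finsupp.sum_single a, Finsupp.sum, map_sum]
      refine sum_mem fun k _ => ?_
      refine ⟨opForm d m (a k • hatForm (Fin.last d)) (Finsupp.single k 1),
        opForm_mem_relCochains (funext fun S => ?_) _, ?_⟩
      · change resHom d m (a k * _) = 0
        rw [map_mul, resHom_apply, ha', zero_mul]
      · have e : opForm d m (a k • hatForm (Fin.last d)) (Finsupp.single k 1) =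
            opForm d m (hatForm (Fin.last d)) (Finsupp.single k (a k)) := by
          refine LinearMap.ext fun f => ?_
          rw [opForm_apply, opForm_apply, opOf_single, opOf_single, smul_smul, one_mul, mul_comm]
        rw [e, spencer_opForm_hatForm]
        rfl

/-! ### The Euler maps -/

/-- `E` as a linear map in the coefficients. -/
def eulerLin (d m : ℕ) : Coeffs d m →ₗ[ℝ] KappaDag d m :=
  Finsupp.lsum ℝ fun k =>
    { toFun := fun c => ((-1 : FunG d m) ^ (∑ i, k.2 i) * DI d m k.2 c) • D0 d m k.1
      map_add' := fun a b => by rw [map_add, mul_add, add_smul]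
      map_smul' := fun r a => by rw [map_smul, mul_smul_comm, smul_assoc]; rfl }

theorem eulerLin_single {d m : ℕ} (k : Fin m × MIdx (d + 1)) (c : FunG d m) :
    eulerLin d m (Finsupp.single k c) =
      ((-1 : FunG d m) ^ (∑ i, k.2 i) * DI d m k.2 c) • D0 d m k.1 := by
  simp [eulerLin]

/-- The contribution of the monomial `c D_{x_n}^s D_J^{(j)}` to `E^∂`, where `J` only involves
`x_1, …, x_{n-1}`. -/
def bdTerm (d m : ℕ) (j : Fin m) (J : MIdx d) (s : ℕ) : FunG d m →ₗ[ℝ] KappaDagBd d m :=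
  ∑ α ∈ Finset.range s,
    { toFun := fun c => ((-1 : FunBd d m) ^ (∑ i, J i) * (-1 : FunBd d m) ^ α *
        DIBd d m J (res d m ((D d m (Fin.last d) ^ α : Module.End ℝ (FunG d m)) c))) •
          D0Bd d m j (s - α - 1)
      map_add' := fun a b => by
        rw [map_add, ← resHom_apply, map_add, map_add, mul_add, add_smul]; rfl
      map_smul' := fun r a => by
        rw [map_smul, res_smul, map_smul, mul_smul_comm, smul_assoc]; rfl }

theorem bdTerm_apply {d m : ℕ} (j : Fin m) (J : MIdx d) (s : ℕ) (c : FunG d m) :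
    bdTerm d m j J s c = ∑ α ∈ Finset.range s,
      ((-1 : FunBd d m) ^ (∑ i, J i) * (-1 : FunBd d m) ^ α *
        DIBd d m J (res d m ((D d m (Fin.last d) ^ α : Module.End ℝ (FunG d m)) c))) •
          D0Bd d m j (s - α - 1) := by
  rw [bdTerm, LinearMap.sum_apply]
  rfl

/-- `E^∂` as a linear map in the coefficients. -/
def eulerBdLin (d m : ℕ) : Coeffs d m →ₗ[ℝ] KappaDagBd d m :=
  Finsupp.lsum ℝ fun k => bdTerm d m k.1 (Fin.init k.2) (k.2 (Fin.last d))

theorem eulerBdLin_apply {d m : ℕ} (a : Coeffs d m) : eulerBdLin d m a = eulerBd d m a := by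
  rw [eulerBdLin, Finsupp.lsum_apply, eulerBd]
  refine Finsupp.sum_congr fun k _ => ?_
  have h : (∑ i, k.2 i) - k.2 (Fin.last d) = ∑ i, (Fin.init k.2 : MIdx d) i := by
    rw [Fin.sum_univ_castSucc, Nat.add_sub_cancel]
    rfl
  rw [bdTerm_apply, h]

theorem eulerBdLin_single {d m : ℕ} (k : Fin m × MIdx (d + 1)) (c : FunG d m) :
    eulerBdLin d m (Finsupp.single k c) = bdTerm d m k.1 (Fin.init k.2) (k.2 (Fin.last d)) c := by
  simp [eulerBdLin]

theorem sum_add_unitIdx {n : ℕ} (I : MIdx n) (i : Fin n) :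
    ∑ k, (I + unitIdx i) k = (∑ k, I k) + 1 := by
  simp [Finset.sum_add_distrib, unitIdx]

theorem D_last_pow_D {d m : ℕ} (i : Fin (d + 1)) (α : ℕ) (c : FunG d m) :
    (D d m (Fin.last d) ^ α : Module.End ℝ (FunG d m)) (D d m i c) =
      D d m i ((D d m (Fin.last d) ^ α : Module.End ℝ (FunG d m)) c) :=
  LinearMap.congr_fun ((D_commute (m := m) (Fin.last d) i).pow_left α).eq c

theorem eulerLin_derivCoeffs {d m : ℕ} (i : Fin (d + 1)) (a : Coeffs d m) :
    eulerLin d m (derivCoeffs d m i a) = 0 := by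
  induction a using Finsupp.induction_linear with
  | zero => simp
  | add a b ha hb => rw [map_add, map_add, ha, hb, add_zero]
  | single k c =>
    rw [derivCoeffs_single, map_add, eulerLin_single, eulerLin_single]
    dsimp only
    rw [← add_smul, sum_add_unitIdx, DI_add_unitIdx, DI_D, pow_succ]
    simp

theorem eulerBdLin_derivCoeffs_castSucc {d m : ℕ} (i : Fin d) (a : Coeffs d m) :
    eulerBdLin d m (derivCoeffs d m i.castSucc a) = 0 := by
  induction a using Finsupp.induction_linear with
  | zero => simp
  | add a b ha hb => rw [map_add, map_add, ha, hb, add_zero]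
  | single k c =>
    have hl : (k.2 + unitIdx i.castSucc) (Fin.last d) = k.2 (Fin.last d) := by
      simp [unitIdx, (Fin.castSucc_lt_last i).ne']
    have hi : (Fin.init (k.2 + unitIdx i.castSucc) : MIdx d) = Fin.init k.2 + unitIdx i := by
      funext t
      simp [Fin.init, unitIdx, Pi.single_apply]
    rw [derivCoeffs_single, map_add, eulerBdLin_single, eulerBdLin_single]
    dsimp only
    rw [hl, hi, bdTerm_apply, bdTerm_apply, ← Finset.sum_add_distrib]
    refine Finset.sum_eq_zero fun α _ => ?_
    rw [← add_smul, sum_add_unitIdx, DIBd_add_unitIdx, D_last_pow_D, res_D_castSucc, DIBd_DBd,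
      pow_succ]
    simp

/-- The contributions to `E^∂` of the two terms of `D_{x_n} ∘ c D_I^{(j)}` cancel, except for the
one with `α = 0`, which is a tangential derivative of `c|_{∂G}` and so vanishes here. -/
theorem eulerBdLin_derivCoeffs_last {d m : ℕ} {a : Coeffs d m} (ha : ∀ k, res d m (a k) = 0) :
    eulerBdLin d m (derivCoeffs d m (Fin.last d) a) = 0 := by
  rw [← Finsupp.sum_single a, Finsupp.sum, map_sum, map_sum]
  refine Finset.sum_eq_zero fun k _ => ?_
  have hl : (k.2 + unitIdx (Fin.last d)) (Fin.last d) = k.2 (Fin.last d) + 1 := by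
    simp [unitIdx]
  have hi : (Fin.init (k.2 + unitIdx (Fin.last d)) : MIdx d) = Fin.init k.2 := by
    funext t
    simp [Fin.init, unitIdx, (Fin.castSucc_lt_last t).ne]
  rw [derivCoeffs_single, map_add, eulerBdLin_single, eulerBdLin_single]
  dsimp only
  rw [hl, hi, bdTerm_apply, bdTerm_apply, Finset.sum_range_succ', pow_zero (D d m (Fin.last d)),
    Module.End.one_apply, ha, map_zero, mul_zero, zero_smul, add_zero, ← Finset.sum_add_distrib]
  refine Finset.sum_eq_zero fun α _ => ?_
  have hs : k.2 (Fin.last d) + 1 - (α + 1) - 1 = k.2 (Fin.last d) - α - 1 := by omega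
  rw [hs, ← add_smul, pow_succ (D d m (Fin.last d)), Module.End.mul_apply, pow_succ _ α]
  simp

/-- The two Euler maps together. -/
def eulerPair (d m : ℕ) : Coeffs d m →ₗ[ℝ] KappaDag d m × KappaDagBd d m :=
  (eulerLin d m).prod (eulerBdLin d m)

theorem coboundaryCoeffs_le_ker (d m : ℕ) :
    coboundaryCoeffs d m ≤ LinearMap.ker (eulerPair d m) := by
  refine sup_le (iSup_le fun i => ?_) ?_
  · rintro _ ⟨a, rfl⟩
    exact LinearMap.mem_ker.2
      (Prod.ext (eulerLin_derivCoeffs _ a) (eulerBdLin_derivCoeffs_castSucc i a))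
  · rintro _ ⟨a, ha, rfl⟩
    refine LinearMap.mem_ker.2 (Prod.ext (eulerLin_derivCoeffs _ a)
      (eulerBdLin_derivCoeffs_last fun k => ?_))
    simpa using DFunLike.congr_fun (LinearMap.mem_ker.1 ha) k

/-! ### Normal forms modulo coboundaries -/

/-- The multi-index of `D_{x_n}^s`. -/
def normalIdx (d s : ℕ) : MIdx (d + 1) := Fin.snoc (α := fun _ => ℕ) (0 : MIdx d) s

theorem normalIdx_zero (d : ℕ) : normalIdx d 0 = 0 := by
  funext i
  refine Fin.lastCases ?_ (fun i => ?_) i <;> simp [normalIdx]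

theorem snoc_add_unitIdx_castSucc {d : ℕ} (J : MIdx d) (s : ℕ) (i : Fin d) :
    (Fin.snoc (α := fun _ => ℕ) (J + unitIdx i) s : MIdx (d + 1)) =
      (Fin.snoc (α := fun _ => ℕ) J s : MIdx (d + 1)) + unitIdx i.castSucc := by
  funext k
  refine Fin.lastCases ?_ (fun k => ?_) k
  · simp [unitIdx, (Fin.castSucc_lt_last i).ne']
  · simp [unitIdx, Pi.single_apply]

theorem normalIdx_succ (d s : ℕ) : normalIdx d (s + 1) = normalIdx d s + unitIdx (Fin.last d) := by
  funext k
  refine Fin.lastCases ?_ (fun k => ?_) k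
  · simp [unitIdx, normalIdx]
  · simp [unitIdx, normalIdx, (Fin.castSucc_lt_last k).ne]

/-- The coefficients of the operator `∑ b_j^s D_{x_n}^s ∘ D_0^{(j)}`. -/
def normalCoeffs (d m : ℕ) : (Fin m × ℕ →₀ FunG d m) →ₗ[ℝ] Coeffs d m :=
  Finsupp.lmapDomain _ ℝ fun k => (k.1, normalIdx d k.2)

theorem normalCoeffs_single {d m : ℕ} (k : Fin m × ℕ) (c : FunG d m) :
    normalCoeffs d m (Finsupp.single k c) = Finsupp.single (k.1, normalIdx d k.2) c := by
  simp [normalCoeffs]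

/-- Integration by parts in `x_1, …, x_{n-1}` removes the derivatives in these variables. -/
theorem exists_single_sub_normalCoeffs_mem {d m : ℕ} (j : Fin m) (J : MIdx d) (s : ℕ)
    (c : FunG d m) : ∃ b, Finsupp.single (j, (Fin.snoc (α := fun _ => ℕ) J s : MIdx (d + 1))) c -
      normalCoeffs d m b ∈ coboundaryCoeffs d m := by
  induction J using MIdx.induction generalizing c with
  | zero =>
    refine ⟨Finsupp.single (j, s) c, ?_⟩
    rw [normalCoeffs_single, normalIdx, sub_self]
    exact zero_mem _
  | add J i ih =>
    obtain ⟨b, hb⟩ := ih (-D d m i.castSucc c)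
    refine ⟨b, ?_⟩
    have h := mem_coboundaryCoeffs_castSucc i
      (Finsupp.single (j, (Fin.snoc (α := fun _ => ℕ) J s : MIdx (d + 1))) c)
    rw [derivCoeffs_single, ← snoc_add_unitIdx_castSucc] at h
    have h' := add_mem h hb
    rw [Finsupp.single_neg] at h'
    convert h' using 1
    abel

theorem exists_sub_normalCoeffs_mem {d m : ℕ} (a : Coeffs d m) :
    ∃ b, a - normalCoeffs d m b ∈ coboundaryCoeffs d m := by
  induction a using Finsupp.induction_linear with
  | zero => exact ⟨0, by simp⟩
  | add a a' ha ha' =>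
    obtain ⟨b, hb⟩ := ha
    obtain ⟨b', hb'⟩ := ha'
    refine ⟨b + b', ?_⟩
    rw [map_add, add_sub_add_comm]
    exact add_mem hb hb'
  | single k c =>
    obtain ⟨b, hb⟩ := exists_single_sub_normalCoeffs_mem k.1 (Fin.init k.2) (k.2 (Fin.last d)) c
    refine ⟨b, ?_⟩
    rwa [Fin.snoc_init_self] at hb

theorem eulerBdLin_normalCoeffs {d m : ℕ} (b : Fin m × ℕ →₀ FunG d m) :
    eulerBdLin d m (normalCoeffs d m b) = b.sum fun k c => bdTerm d m k.1 0 k.2 c := by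
  induction b using Finsupp.induction_linear with
  | zero => simp
  | add b b' hb hb' =>
    rw [map_add, map_add, hb, hb', Finsupp.sum_add_index'] <;> simp
  | single k c =>
    rw [normalCoeffs_single, eulerBdLin_single, Finsupp.sum_single_index (by simp)]
    simp only [normalIdx, Fin.init_snoc, Fin.snoc_last]

open Classical in
theorem D0Bd_apply_single {d m : ℕ} (j j' : Fin m) (α β : ℕ) :
    (D0Bd d m j' β).1 (Pi.single (j, α) 1) = if (j', β) = (j, α) then 1 else 0 := by
  simp [D0Bd, Pi.single_apply]

open Classical in
/-- Of the operators of order at most `N + 1` in normal form, only the leading term contributes to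
the coefficient of `D_0^{(j,N)}` in `E^∂`. -/
theorem bdTerm_apply_single {d m : ℕ} (j j' : Fin m) {s N : ℕ} (hs : s ≤ N + 1) (c : FunG d m) :
    (bdTerm d m j' 0 s c).1 (Pi.single (j, N) 1) =
      if (j', s) = (j, N + 1) then res d m c else 0 := by
  rw [bdTerm_apply, Submodule.coe_sum, LinearMap.sum_apply]
  have h0 : ∀ α, α ≠ 0 ∨ s ≠ N + 1 → ∀ x : FunBd d m, α < s →
      (x • D0Bd d m j' (s - α - 1)).1 (Pi.single (j, N) 1) = 0 := fun α hα x hαs => by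
    rw [Submodule.coe_smul, LinearMap.smul_apply, D0Bd_apply_single, if_neg, smul_zero]
    intro e
    have := congrArg Prod.snd e
    dsimp only at this
    omega
  by_cases hsN : s = N + 1
  · subst hsN
    rw [Finset.sum_eq_single 0 (fun α hα hne => h0 α (Or.inl hne) _ (Finset.mem_range.1 hα))
      (by simp), Submodule.coe_smul, LinearMap.smul_apply, D0Bd_apply_single]
    simp
  · rw [if_neg (fun e => hsN (congrArg Prod.snd e))]
    exact Finset.sum_eq_zero fun α hα => h0 α (Or.inr hsN) _ (Finset.mem_range.1 hα)

/-- If the Euler expressions of an operator in normal form vanish, then its leading coefficients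
vanish on `∂G`, so that it can be integrated by parts in `x_n`, modulo coboundaries; in order zero,
the operator is its own Euler expression. -/
theorem normalCoeffs_mem_of_eulerPair_eq_zero {d m : ℕ} (N : ℕ) (b : Fin m × ℕ →₀ FunG d m)
    (hN : ∀ k, N < k.2 → b k = 0) (hb : eulerPair d m (normalCoeffs d m b) = 0) :
    normalCoeffs d m b ∈ coboundaryCoeffs d m := by
  classical
  induction N generalizing b with
  | zero =>
    suffices h : b = 0 by rw [h, map_zero]; exact zero_mem _
    have h1 : ∀ b' : Fin m × ℕ →₀ FunG d m, ∀ j, (∀ k, 0 < k.2 → b' k = 0) →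
        eulerLin d m (normalCoeffs d m b') (Pi.single j 1) = b' (j, 0) := by
      intro b' j hb'
      rw [← Finsupp.sum_single b', Finsupp.sum, map_sum, map_sum, LinearMap.sum_apply,
        Finsupp.finsetSum_apply]
      refine Finset.sum_congr rfl fun k hk => ?_
      obtain ⟨j', s⟩ := k
      obtain rfl : s = 0 := by
        by_contra h
        exact Finsupp.mem_support_iff.1 hk (hb' _ (Nat.pos_of_ne_zero h))
      rw [normalCoeffs_single, eulerLin_single]
      simp [normalIdx_zero, D0, Pi.single_apply, Finsupp.single_apply]
    ext1 ⟨j, s⟩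
    rcases Nat.eq_zero_or_pos s with rfl | hs
    · rw [← h1 b j hN, show eulerLin d m (normalCoeffs d m b) = 0 from congrArg Prod.fst hb]
      rfl
    · exact hN _ hs
  | succ N ih =>
    have hres : ∀ j, res d m (b (j, N + 1)) = 0 := fun j => by
      have h : eulerBdLin d m (normalCoeffs d m b) = 0 := congrArg Prod.snd hb
      rw [eulerBdLin_normalCoeffs] at h
      have h' := congrArg (fun x : KappaDagBd d m => x.1 (Pi.single (j, N) 1)) h
      rw [Finsupp.sum, Submodule.coe_sum, LinearMap.sum_apply,
        Finset.sum_congr rfl (g := fun k => if k = (j, N + 1) then res d m (b k) else 0)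
          fun k hk => bdTerm_apply_single j k.1
            (not_lt.1 fun hlt => Finsupp.mem_support_iff.1 hk (hN k hlt)) (b k),
        Finset.sum_ite_eq'] at h'
      split_ifs at h' with hk
      · exact h'
      · rw [Finsupp.notMem_support_iff.1 hk, res_zero]
    -- `w` is a coboundary with the same terms of order `N + 1` as `b`
    let u : Coeffs d m := ∑ j, Finsupp.single (j, normalIdx d N) (b (j, N + 1))
    let w : Fin m × ℕ →₀ FunG d m := ∑ j, (Finsupp.single (j, N) (D d m (Fin.last d) (b (j, N + 1)))
      + Finsupp.single (j, N + 1) (b (j, N + 1)))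
    have hw : normalCoeffs d m w = derivCoeffs d m (Fin.last d) u := by
      simp only [w, u, map_sum, map_add, normalCoeffs_single, derivCoeffs_single, normalIdx_succ]
    have hwC : normalCoeffs d m w ∈ coboundaryCoeffs d m := by
      rw [hw]
      refine mem_coboundaryCoeffs_last fun k => ?_
      rw [Finsupp.finsetSum_apply, ← resHom_apply, map_sum]
      refine Finset.sum_eq_zero fun j _ => ?_
      rw [Finsupp.single_apply]
      split_ifs
      · exact hres j
      · exact map_zero _
    have h := ih (b - w) ?_ ?_
    · rw [map_sub] at h
      simpa using add_mem h hwC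
    · rintro ⟨j, s⟩ hs
      have hs' : N ≠ s := (show N < s from hs).ne
      have e : w (j, s) = if N + 1 = s then b (j, N + 1) else 0 := by
        simp [w, Finsupp.finsetSum_apply, Finsupp.single_apply, hs', ite_and]
      rw [Finsupp.sub_apply, e]
      split_ifs with h
      · rw [h, sub_self]
      · rw [hN _ (show N + 1 < s by change N < s at hs; omega), sub_zero]
    · rw [map_sub, map_sub, hb, zero_sub, neg_eq_zero]
      exact coboundaryCoeffs_le_ker d m hwC

theorem ker_eulerPair (d m : ℕ) : LinearMap.ker (eulerPair d m) = coboundaryCoeffs d m := by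
  refine le_antisymm (fun a ha => ?_) (coboundaryCoeffs_le_ker d m)
  obtain ⟨b, hb⟩ := exists_sub_normalCoeffs_mem a
  have hb0 : eulerPair d m (normalCoeffs d m b) = 0 := by
    have h := LinearMap.mem_ker.1 (coboundaryCoeffs_le_ker d m hb)
    rwa [map_sub, LinearMap.mem_ker.1 ha, zero_sub, neg_eq_zero] at h
  have hmem := normalCoeffs_mem_of_eulerPair_eq_zero (b.support.sup Prod.snd) b (fun k hk => by
    by_contra h
    exact absurd (Finset.le_sup (f := Prod.snd) (Finsupp.mem_support_iff.2 h)) hk.not_ge) hb0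
  simpa using add_mem hb hmem

/-! ### Surjectivity of the Euler maps -/

/-- `E^∂` of `c D_{x_n}^{α+1} ∘ D_0^{(j)}` has the leading term `c|_{∂G} D_0^{(j,α)}`. -/
theorem smul_D0Bd_mem_range {d m : ℕ} (j : Fin m) (α : ℕ) (g : FunBd d m) :
    g • D0Bd d m j α ∈ LinearMap.range (eulerBdLin d m) := by
  induction α using Nat.strong_induction_on generalizing g with
  | _ α ih =>
    obtain ⟨c, rfl⟩ := res_surjective d m g
    have h : eulerBdLin d m (normalCoeffs d m (Finsupp.single (j, α + 1) c)) ∈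
        LinearMap.range (eulerBdLin d m) := ⟨_, rfl⟩
    rw [eulerBdLin_normalCoeffs, Finsupp.sum_single_index (by simp), bdTerm_apply,
      Finset.sum_range_succ'] at h
    have h' := (Submodule.add_mem_iff_right _ (Submodule.sum_mem _ fun β hβ =>
      ih (α + 1 - (β + 1) - 1) (by have := Finset.mem_range.1 hβ; omega) _)).1 h
    simpa using h'

theorem eulerBdLin_surjective (d m : ℕ) : Function.Surjective (eulerBdLin d m) := by
  rintro ⟨x, hx⟩
  obtain ⟨c, rfl⟩ := Finsupp.mem_span_range_iff_exists_finsupp.1 hx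
  change _ ∈ LinearMap.range (eulerBdLin d m)
  have h : (c.sum fun k g => g • D0Bd d m k.1 k.2) ∈ LinearMap.range (eulerBdLin d m) :=
    Submodule.sum_mem _ fun k _ => smul_D0Bd_mem_range k.1 k.2 (c k)
  convert h
  rw [Finsupp.sum, Finsupp.sum, Submodule.coe_sum]
  rfl

theorem eulerPair_surjective (d m : ℕ) : Function.Surjective (eulerPair d m) := by
  classical
  rintro ⟨x, y⟩
  obtain ⟨a, rfl⟩ := eulerBdLin_surjective d m y
  -- operators of order zero do not contribute to `E^∂` and can have any Euler expression
  let z : KappaDag d m := x - eulerLin d m a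
  refine ⟨a + ∑ j, Finsupp.single (j, 0) (z (Pi.single j 1)), Prod.ext ?_ ?_⟩
  · change eulerLin d m _ = x
    rw [map_add, map_sum, add_comm, ← eq_sub_iff_add_eq]
    refine LinearMap.pi_ext' fun j => LinearMap.ext_ring ?_
    simp only [LinearMap.comp_apply, LinearMap.sum_apply, eulerLin_single, LinearMap.smul_apply]
    simp [D0, z, Pi.single_apply]
  · change eulerBdLin d m _ = eulerBdLin d m a
    rw [map_add, map_sum, add_eq_left]
    refine Finset.sum_eq_zero fun j _ => ?_
    rw [eulerBdLin_single, bdTerm_apply]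
    simp

/-! ### The cohomology in degree `n` -/

/-- Cocycles of degree `n` correspond to their coefficients. -/
def coordEquiv (d m : ℕ) : Coeffs d m ≃ₗ[ℝ] ↥(relCocycles d m (d + 1)) :=
  LinearEquiv.ofBijective
    ((opForm d m (vol d m)).codRestrict (relCocycles d m (d + 1)) fun a => by
      rw [relCocycles_eq_TopOps]; exact opForm_mem_CDiff _ a)
    ⟨fun _ _ h => coordOp_injective d m (congrArg Subtype.val h), fun B => by
      obtain ⟨a, ha⟩ := mem_TopOps_iff.1 ((relCocycles_eq_TopOps d m).le B.2)
      exact ⟨a, Subtype.ext ha⟩⟩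

theorem exists_equiv_euler (d m : ℕ) : ∃ Φ : K d m ≃ₗ[ℝ] KappaDag d m × KappaDagBd d m,
    ∀ (a : Coeffs d m) (ha : coordOp d m a ∈ relCocycles d m (d + 1)),
      Φ (Submodule.Quotient.mk ⟨coordOp d m a, ha⟩) = (euler d m a, eulerBd d m a) := by
  let ψ := eulerPair d m ∘ₗ (coordEquiv d m).symm.toLinearMap
  have hψ : Function.Surjective ψ :=
    (eulerPair_surjective d m).comp (coordEquiv d m).symm.surjective
  have happly (a : Coeffs d m) : ψ (coordEquiv d m a) = eulerPair d m a :=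
    congrArg (eulerPair d m) ((coordEquiv d m).symm_apply_apply a)
  have hker : (relCoboundaries d m d).comap (relCocycles d m (d + 1)).subtype =
      LinearMap.ker ψ := by
    ext B
    obtain ⟨a, rfl⟩ := (coordEquiv d m).surjective B
    rw [LinearMap.mem_ker, happly, ← LinearMap.mem_ker, ker_eulerPair]
    exact coordOp_mem_relCoboundaries_iff
  refine ⟨(Submodule.quotEquivOfEq _ _ hker).trans (ψ.quotKerEquivOfSurjective hψ),
    fun a ha => ?_⟩
  exact (happly a).trans (Prod.ext rfl (eulerBdLin_apply a))

end RelEuler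

end

open RelEuler
theorem mainTheorem4 (d m : ℕ) :
    -- the relative operators form a subcomplex of the Spencer complex
    (∀ k, relCochains d m k ≤ CDiff d m (Kappa d m) (HForm d m k)) ∧
    (∀ k, (relCochains d m k).map (spencer d m k) ≤ relCochains d m (k + 1)) ∧
    (∀ k, spencer d m (k + 1) ∘ₗ spencer d m k = 0) ∧
    -- its cohomology of degree `n` is the asserted quotient
    relCocycles d m (d + 1) = TopOps d m ∧
    (∃ Θ : K d m ≃ₗ[ℝ] TopQuot d m,
      ∀ (B : Kappa d m →ₗ[ℝ] HForm d m (d + 1)) (hB : B ∈ relCocycles d m (d + 1))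
        (hB' : B ∈ TopOps d m),
        Θ (Submodule.Quotient.mk ⟨B, hB⟩) = Submodule.Quotient.mk ⟨B, hB'⟩) ∧
    -- every cocycle can be written as `a_j^I D_I^{(j)}` in exactly one way
    (∀ B : Kappa d m →ₗ[ℝ] HForm d m (d + 1),
      B ∈ relCocycles d m (d + 1) ↔ ∃ a : Coeffs d m, coordOp d m a = B) ∧
    Function.Injective (coordOp d m) ∧
    -- the class of a cocycle is identified with the pair of its Euler expressions
    ∃ Φ : K d m ≃ₗ[ℝ] KappaDag d m × KappaDagBd d m,
      ∀ (a : Coeffs d m) (ha : coordOp d m a ∈ relCocycles d m (d + 1)),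
        Φ (Submodule.Quotient.mk ⟨coordOp d m a, ha⟩) = (euler d m a, eulerBd d m a) := by
  have hcoc := relCocycles_eq_TopOps d m
  refine ⟨relCochains_le_CDiff d m, map_spencer_relCochains_le d m, spencer_comp_spencer d m, hcoc,
    ⟨Submodule.Quotient.equiv _ _ (LinearEquiv.ofEq _ _ hcoc) ?_, fun _ _ _ => rfl⟩,
    fun B => by rw [hcoc]; exact mem_TopOps_iff, coordOp_injective d m, exists_equiv_euler d m⟩
  ext B
  constructor
  · rintro ⟨B, hB, rfl⟩
    exact hB
  · intro hB
    exact ⟨⟨B.1, hcoc.ge B.2⟩, hB, rfl⟩
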